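/- **Setting.** The correspondence language is first-order logic without identity over the binary predicate letters $R_1,R_2,\dots$ and the unary predicate letters $P_1,P_2,\dots$. Let $\Theta$ be a set of these letters containing all $R_i$. A $\Theta$-formula uses only letters of $\Theta$, a $\Theta$-model is a (non-empty) first-order structure for $\Theta$ with domain $U$, and $\varphi(x)$ indicates that at most $x$ is free in $\varphi$. For a sequence $S=(S_1,\dots,S_m)$ of letters $R_i$ with $m\ge 1$ write $\pi_S(x_1,\dots,x_{m+1})$ for $\bigwedge_{i=1}^m S_i(x_i,x_{i+1})$, and call a sequence of elements of a model satisfying it an $S$-path. **Guarded connectives.** A $k$-ary guarded connective of degree $0$ is a Boolean combination of $P_1(x),\dots,P_k(x)$ ($\top$ and $\bot$ being allowed as nullary ones). If $\mu^-$ is a $k$-ary guarded connective of degree $n$ that is not $\forall$-guarded, then $\mu=\forall x_2\ldots x_{m+1}(\pi_S(x_1,\dots,x_{m+1})\to\mu^-(x_{m+1}))$, with $x_1=x$, is a $\forall$-guarded $k$-ary guarded connective of degree $\delta(\mu)=n+1$, provided it is not logically equivalent to a $k$-ary guarded connective of smaller degree; dually, if $\mu^-$ is not $\exists$-guarded, $\mu=\exists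 x_2\ldots x_{m+1}(\pi_S(x_1,\dots,x_{m+1})\wedge\mu^-(x_{m+1}))$ is $\exists$-guarded of degree $n+1$ under the same proviso. The Boolean function $f$ defined by the innermost Boolean combination is the propositional core of $\mu$. Logically equivalent connectives of the same arity count as the same. The application $\mu(\psi_1,\dots,\psi_k)$ is obtained by replacing each $P_i(w)$ in $\mu$ by $\psi_i(w)$. Order $\{0,1\}^k$ coordinatewise. A Boolean function is a rest function if it is neither monotone nor anti-monotone; it is TFT (resp. FTF) if there are $a<b<c$ on which it takes the values $1,0,1$ (resp. $0,1,0$). It is weakly $\forall$-special if it is not TFT, weakly $\exists$-special if it is not FTF, and $Q$-special if it is a weakly $Q$-special rest function. A guarded connective of degree $1$ with quantifier $Q\in\{\forall,\exists\}$ is (weakly) special if its core is (weakly) $Q$-special. A guarded connective $\mu$ of degree $2$ is regular if $\mu^-$ is weakly special and the core of $\mu$ is not constant. **Fragments.** For a set $\mathbb M$ of guarded connectives, $\mathcal L^\Theta_x(\mathbb M)$ is the least set of formulas containing $P_n(x)$ for all $P_n\in\Theta$ and closed under application of the members of $\mathbb M$. It is standard if $\mathbb M$ is finite and each member of $\mathbb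 M$ has degree at most $1$ or is regular of degree $2$. **Asimulations.** Let $M_1,M_2$ be $\Theta$-models with domains $U_1,U_2$ (taken to be disjoint), and let $W$ be the set of all relations $A\subseteq(U_1\times U_2)\cup(U_2\times U_1)$. A formula $\varphi(x)$ is invariant with respect to $A\in W$ if $a\mathrel A b$ and the truth of $\varphi$ at $a$ imply the truth of $\varphi$ at $b$ (for pairs in either direction); it is invariant with respect to a class of such relations if it is so with respect to each of them. For $\beta\subseteq W$ define sets $[\mu](\beta)$ of $(\delta(\mu)+1)$-tuples of elements of $W$: * if $\delta(\mu)=0$ and $f$ is the core of $\mu$, then $[\mu](\beta)$ is $W$ if $f$ is constant, $\beta$ if $f$ is non-constant monotone, $\{B^{-1}\mid B\in\beta\}$ if $f$ is non-constant anti-monotone, and $\{B\cap B^{-1}\mid B\in\beta\}$ otherwise; * if $\mu$ is guarded and not special, then $\langle A_1,\dots,A_{\delta(\mu)+1}\rangle\in[\mu](\beta)$ iff $\langle A_1,\dots,A_{\delta(\mu)}\rangle\in[\mu^-](\beta)$ and, writing $A=A_{\delta(\mu)+1}$ and $B=A_{\delta(\mu)}$, for both choices of $(r,t)$ with $\{r,t\}=\{1,2\}$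 the following holds. If $\mu$ is $\forall$-guarded: whenever $a_1\in U_r$, $(b_1,\dots,b_{m+1})$ is an $S$-path in $M_t$ and $a_1\mathrel A b_1$, there is an $S$-path $(a_1,\dots,a_{m+1})$ in $M_r$ with $a_{m+1}\mathrel B b_{m+1}$. If $\mu$ is $\exists$-guarded: whenever $(a_1,\dots,a_{m+1})$ is an $S$-path in $M_r$, $b_1\in U_t$ and $a_1\mathrel A b_1$, there is an $S$-path $(b_1,\dots,b_{m+1})$ in $M_t$ with $a_{m+1}\mathrel B b_{m+1}$; * if $\mu$ is special, then $\langle B,A\rangle\in[\mu](\beta)$ iff $B\in\beta$, $A\in W$, and the condition of the previous item (for the quantifier of $\mu$) holds both for $(A,B)$ and for $(A,B^{-1})$. A non-empty $A\in W$ is an $\mathcal L^\Theta_x(\mathbb M)$-asimulation between $M_1$ and $M_2$ if every $P_n(x)$ with $P_n\in\Theta$ is invariant with respect to $A$, and for every $\mu\in\mathbb M$ there are $A_1,\dots,A_{\delta(\mu)}\in W$ with $\langle A_1,\dots,A_{\delta(\mu)},A\rangle\in[\mu](\{A\})$. **Theorem.** Let $\mathcal L^\Theta_x(\mathbb M)$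 be a standard fragment with $\{\wedge,\vee,\bot,\top\}\subseteq\mathbb M$, where $\bot$ and $\top$ are taken as nullary connectives, and let $\varphi(x)$ be a $\Theta$-formula of the correspondence language. Then $\varphi(x)$ is logically equivalent to a formula of $\mathcal L^\Theta_x(\mathbb M)$ if and only if $\varphi(x)$ is invariant with respect to all $\mathcal L^\Theta_x(\mathbb M)$-asimulations, between any two $\Theta$-models. -/

import Mathlib

/-- Predicate letters of the vocabulary: binary letters `R i` for all `i : ℕ`, and unary
letters `P n` for `n ∈ Θ`. A set `Θ` of indices thus stands for the vocabulary that has all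
the binary letters and the unary letters `P n`, `n ∈ Θ`; `Set.univ` gives the full one. -/
inductive CorrRel (Θ : Set ℕ) : ℕ → Type
  | P (n : Θ) : CorrRel Θ 1
  | R (i : ℕ) : CorrRel Θ 2

/-- The correspondence language over `Θ` (no constants, no function symbols). -/
def corrLang (Θ : Set ℕ) : FirstOrder.Language.{0, 0} := ⟨fun _ => Empty, CorrRel Θ⟩

/-- The letter `P n` as a symbol of the language. -/
def symP {Θ : Set ℕ} (n : Θ) : (corrLang Θ).Relations 1 := CorrRel.P n

/-- The letter `R i` as a symbol of the language. -/
def symR {Θ : Set ℕ} (i : ℕ) : (corrLang Θ).Relations 2 := CorrRel.R i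

/-- Formulas `φ(x)` over `Θ` with at most one free variable. -/
abbrev CorrFormula (Θ : Set ℕ) := (corrLang Θ).Formula Unit

/-- The identity symbol does not occur in the formula. -/
def IdentityFree {L : FirstOrder.Language.{0, 0}} {α : Type} : {n : ℕ} → L.BoundedFormula α n → Prop
  | _, .falsum => True
  | _, .equal _ _ => False
  | _, .rel _ _ => True
  | _, .imp φ ψ => IdentityFree φ ∧ IdentityFree ψ
  | _, .all φ => IdentityFree φ

/-- The atomic formula `P n (x)`. -/
def atomP {Θ : Set ℕ} (n : Θ) : CorrFormula Θ :=
  FirstOrder.Language.Relations.formula₁ (symP n) (FirstOrder.Language.Term.var ())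

/-- Truth of `φ(x)` at a pointed model `(M, a)`. -/
def TrueAt {Θ : Set ℕ} {U : Type*} [(corrLang Θ).Structure U] (a : U) (φ : CorrFormula Θ) :
    Prop :=
  φ.Realize (fun _ => a)

/-! ### Boolean functions -/

/-- Boolean combinations of the `k` atoms `P 0 (x), …, P (k - 1) (x)`. -/
inductive BoolComb (k : ℕ) : Type
  | atom (i : Fin k) : BoolComb k
  | top : BoolComb k
  | bot : BoolComb k
  | neg (b : BoolComb k) : BoolComb k
  | and (b c : BoolComb k) : BoolComb k
  | or (b c : BoolComb k) : BoolComb k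

namespace BoolComb

/-- The Boolean function defined by a Boolean combination. -/
def eval {k : ℕ} : BoolComb k → (Fin k → Bool) → Bool
  | atom i, v => v i
  | top, _ => true
  | bot, _ => false
  | neg b, v => !(b.eval v)
  | and b c, v => b.eval v && c.eval v
  | or b c, v => b.eval v || c.eval v

/-- Replace the `i`-th atom by the formula `ψ i`. -/
def apply {Θ : Set ℕ} {k : ℕ} : BoolComb k → (Fin k → CorrFormula Θ) → CorrFormula Θ
  | atom i, ψ => ψ i
  | top, _ => ⊤
  | bot, _ => ⊥
  | neg b, ψ => (b.apply ψ).not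
  | and b c, ψ => b.apply ψ ⊓ c.apply ψ
  | or b c, ψ => b.apply ψ ⊔ c.apply ψ

end BoolComb

def IsConstantFn {k : ℕ} (f : (Fin k → Bool) → Bool) : Prop := ∀ a b, f a = f b

/-- Neither monotone nor anti-monotone (tuples are ordered coordinatewise, `false < true`). -/
def IsRest {k : ℕ} (f : (Fin k → Bool) → Bool) : Prop := ¬ Monotone f ∧ ¬ Antitone f

def IsTFT {k : ℕ} (f : (Fin k → Bool) → Bool) : Prop :=
  ∃ a b c, a < b ∧ b < c ∧ f a = true ∧ f b = false ∧ f c = true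

def IsFTF {k : ℕ} (f : (Fin k → Bool) → Bool) : Prop :=
  ∃ a b c, a < b ∧ b < c ∧ f a = false ∧ f b = true ∧ f c = false

inductive Quant : Type
  | all
  | ex

/-- Weakly `∀`-special: not `TFT`; weakly `∃`-special: not `FTF`. -/
def WeaklySpecialFn {k : ℕ} : Quant → ((Fin k → Bool) → Bool) → Prop
  | .all, f => ¬ IsTFT f
  | .ex, f => ¬ IsFTF f

/-- `Q`-special: a rest function that is weakly `Q`-special. -/
def SpecialFn {k : ℕ} (Q : Quant) (f : (Fin k → Bool) → Bool) : Prop :=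
  IsRest f ∧ WeaklySpecialFn Q f

/-! ### Guarded connectives -/

/-- Expressions of the shape of a `k`-ary guarded connective: a Boolean combination under a
sequence of guarded quantifier blocks. `guard Q m S μ` stands for
`∀ x₂ … x_{m+2} (S₁(x₁,x₂) ∧ … ∧ S_{m+1}(x_{m+1},x_{m+2}) → μ(x_{m+2}))` if `Q` is `∀`,
and for the dual formula with `∃` and `∧` if `Q` is `∃`. -/
inductive PreConn (k : ℕ) : Type
  | core (b : BoolComb k) : PreConn k
  | guard (Q : Quant) (m : ℕ) (S : Fin (m + 1) → ℕ) (μ : PreConn k) : PreConn k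

/-- The variables `x₁, …, x_{m+1}`: the free variable followed by `m` bound ones. -/
def pathVar {Θ : Set ℕ} (m : ℕ) : Fin (m + 1) → (corrLang Θ).Term (Unit ⊕ Fin m) :=
  Fin.cases (FirstOrder.Language.Term.var (Sum.inl ())) (fun i => FirstOrder.Language.Term.var (Sum.inr i))

/-- The conjunction `⋀ Sᵢ(xᵢ, xᵢ₊₁)`. -/
noncomputable def pathFormula {Θ : Set ℕ} {m : ℕ} (S : Fin (m + 1) → ℕ) :
    (corrLang Θ).BoundedFormula Unit (m + 1) :=
  FirstOrder.Language.BoundedFormula.iInf fun i : Fin (m + 1) =>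
    FirstOrder.Language.Relations.boundedFormula₂ (symR (S i))
      (pathVar (m + 1) i.castSucc) (pathVar (m + 1) i.succ)

/-- The formula `ψ(x_{m+2})`, as a formula in the variables `x₁, …, x_{m+2}`. -/
def atLast {Θ : Set ℕ} (m : ℕ) (ψ : CorrFormula Θ) :
    (corrLang Θ).BoundedFormula Unit (m + 1) :=
  FirstOrder.Language.BoundedFormula.relabel (n := m + 1) (k := 0) (fun _ => Sum.inr (Fin.last m)) ψ

noncomputable def guardFormula {Θ : Set ℕ} (Q : Quant) {m : ℕ} (S : Fin (m + 1) → ℕ)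
    (ψ : CorrFormula Θ) : CorrFormula Θ :=
  match Q with
  | .all => ((pathFormula S).imp (atLast m ψ)).alls
  | .ex => (pathFormula S ⊓ atLast m ψ).exs

namespace PreConn

variable {k : ℕ}

/-- The number of quantifier blocks. -/
def degree : PreConn k → ℕ
  | core _ => 0
  | guard _ _ _ μ => μ.degree + 1

def propCore : PreConn k → BoolComb k
  | core b => b
  | guard _ _ _ μ => μ.propCore

/-- `μ` is `Q`-guarded. -/
def IsGuardedBy (Q : Quant) : PreConn k → Prop
  | core _ => False
  | guard Q' _ _ _ => Q' = Q

/-- The application `μ(ψ₁, …, ψ_k)`. -/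
noncomputable def apply {Θ : Set ℕ} : PreConn k → (Fin k → CorrFormula Θ) → CorrFormula Θ
  | core b, ψ => b.apply ψ
  | guard Q _ S μ, ψ => guardFormula Q S (μ.apply ψ)

/-- `μ` as a formula of the full correspondence language. -/
noncomputable def toFormula (μ : PreConn k) : CorrFormula Set.univ :=
  μ.apply fun i => atomP ⟨i, Set.mem_univ _⟩

/-- `μ` and `ν` are logically equivalent as formulas. -/
def Equivalent {l : ℕ} (μ : PreConn k) (ν : PreConn l) : Prop :=
  (∅ : (corrLang Set.univ).Theory).Iff μ.toFormula ν.toFormula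

/-- `μ` is a `k`-ary guarded connective (of degree `μ.degree`): the quantifier blocks alternate,
and neither `μ` nor any ancestor of it is equivalent to a `k`-ary guarded connective of smaller
degree. -/
def IsGuardedConnective : PreConn k → Prop
  | core _ => True
  | guard Q m S μ =>
      μ.IsGuardedConnective ∧ ¬ μ.IsGuardedBy Q ∧
        ¬ ∃ ν : PreConn k, ∃ _ : ν.degree < μ.degree + 1,
          ν.IsGuardedConnective ∧ (guard Q m S μ).Equivalent ν
termination_by μ => μ.degree
decreasing_by
  all_goals simp only [degree]
  all_goals omega

/-- `ν` is `μ` itself or an ancestor of `μ`. -/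
def HasAncestor : PreConn k → PreConn k → Prop
  | core b, ν => ν = core b
  | guard Q m S μ, ν => ν = guard Q m S μ ∨ μ.HasAncestor ν

/-- Degree `1`, with a `Q`-special propositional core, where `Q` is the quantifier. -/
def IsSpecial : PreConn k → Prop
  | guard Q _ _ (core b) => SpecialFn Q b.eval
  | _ => False

/-- Degree `1`, with a weakly `Q`-special propositional core, where `Q` is the quantifier. -/
def IsWeaklySpecial : PreConn k → Prop
  | guard Q _ _ (core b) => WeaklySpecialFn Q b.eval
  | _ => False

def IsFlat (μ : PreConn k) : Prop := μ.degree ≤ 1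

def IsRegular (μ : PreConn k) : Prop :=
  (∃ ν, μ.HasAncestor ν ∧ ν.degree = 1 ∧ ν.IsWeaklySpecial) ∧ ¬ IsConstantFn μ.propCore.eval

end PreConn

/-- A connective together with its arity. -/
abbrev Conn := Σ k : ℕ, PreConn k

def connAnd : Conn := ⟨2, .core (.and (.atom 0) (.atom 1))⟩
def connOr : Conn := ⟨2, .core (.or (.atom 0) (.atom 1))⟩
def connTop : Conn := ⟨0, .core .top⟩
def connBot : Conn := ⟨0, .core .bot⟩

/-- `ν` belongs to `𝕄`, where equivalent connectives of the same arity count as one and the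
same. -/
def ContainsConn (𝕄 : Set Conn) (ν : Conn) : Prop :=
  ∃ μ ∈ 𝕄, μ.1 = ν.1 ∧ μ.2.Equivalent ν.2

/-- `𝕄` is a finite set of guarded connectives, each of which is flat or else regular of
degree `2`. -/
def IsStandard (𝕄 : Set Conn) : Prop :=
  𝕄.Finite ∧ ∀ μ ∈ 𝕄, μ.2.IsGuardedConnective ∧
    (μ.2.IsFlat ∨ (μ.2.IsRegular ∧ μ.2.degree = 2))

/-- The fragment generated by `𝕄` from the atoms `P n (x)`, `n ∈ Θ`. -/
inductive Fragment (Θ : Set ℕ) (𝕄 : Set Conn) : CorrFormula Θ → Prop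
  | atom (n : Θ) : Fragment Θ 𝕄 (atomP n)
  | app (μ : Conn) (hμ : μ ∈ 𝕄) (ψ : Fin μ.1 → CorrFormula Θ)
      (hψ : ∀ i, Fragment Θ 𝕄 (ψ i)) : Fragment Θ 𝕄 (μ.2.apply ψ)

/-! ### Asimulations -/

/-- A binary relation `A ⊆ (U₁ × U₂) ∪ (U₂ × U₁)`, where the domains are taken to be disjoint:
`fwd` is its part in `U₁ × U₂` and `bwd` its part in `U₂ × U₁`. -/
@[ext]
structure BiRel (U₁ U₂ : Type*) where
  fwd : U₁ → U₂ → Prop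
  bwd : U₂ → U₁ → Prop

namespace BiRel

variable {U₁ U₂ : Type*}

def inv (A : BiRel U₁ U₂) : BiRel U₁ U₂ := ⟨fun a b => A.bwd b a, fun b a => A.fwd a b⟩

def inter (A B : BiRel U₁ U₂) : BiRel U₁ U₂ :=
  ⟨fun a b => A.fwd a b ∧ B.fwd a b, fun b a => A.bwd b a ∧ B.bwd b a⟩

def IsNonempty (A : BiRel U₁ U₂) : Prop := (∃ a b, A.fwd a b) ∨ ∃ b a, A.bwd b a

end BiRel

/-- `c₁ S₁ c₂ S₂ … S_{m+1} c_{m+2}`. -/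
def IsPath (Θ : Set ℕ) {U : Type*} [(corrLang Θ).Structure U] {m : ℕ} (S : Fin (m + 1) → ℕ)
    (c : Fin (m + 2) → U) : Prop :=
  ∀ i : Fin (m + 1),
    FirstOrder.Language.Structure.RelMap (symR (Θ := Θ) (S i)) ![c i.castSucc, c i.succ]

section

variable (Θ : Set ℕ)

/-- For `a₁ ∈ U`, `b ∈ V` with `a₁ A b₁` and an `S`-path `b` there is an `S`-path `a` from `a₁`
with `a_{m+2} B b_{m+2}`. -/
def Back {U V : Type*} [(corrLang Θ).Structure U] [(corrLang Θ).Structure V] {m : ℕ}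
    (S : Fin (m + 1) → ℕ) (A B : U → V → Prop) : Prop :=
  ∀ (a₁ : U) (b : Fin (m + 2) → V), A a₁ (b 0) → IsPath Θ S b →
    ∃ a : Fin (m + 2) → U, a 0 = a₁ ∧ IsPath Θ S a ∧ B (a (Fin.last _)) (b (Fin.last _))

/-- For `b₁ ∈ V`, `a ∈ U` with `a₁ A b₁` and an `S`-path `a` there is an `S`-path `b` from `b₁`
with `a_{m+2} B b_{m+2}`. -/
def Forth {U V : Type*} [(corrLang Θ).Structure U] [(corrLang Θ).Structure V] {m : ℕ}
    (S : Fin (m + 1) → ℕ) (A B : U → V → Prop) : Prop :=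
  ∀ (a : Fin (m + 2) → U) (b₁ : V), A (a 0) b₁ → IsPath Θ S a →
    ∃ b : Fin (m + 2) → V, b 0 = b₁ ∧ IsPath Θ S b ∧ B (a (Fin.last _)) (b (Fin.last _))

variable {U₁ U₂ : Type*} [(corrLang Θ).Structure U₁] [(corrLang Θ).Structure U₂]

/-- The conditions `back` (for `∀`) and `forth` (for `∃`), in both directions. -/
def StepCond {m : ℕ} (Q : Quant) (S : Fin (m + 1) → ℕ) (A B : BiRel U₁ U₂) : Prop :=
  match Q with
  | .all => Back Θ S A.fwd B.fwd ∧ Back Θ S A.bwd B.bwd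
  | .ex => Forth Θ S A.fwd B.fwd ∧ Forth Θ S A.bwd B.bwd

/-- The conditions `s-back` (for `∀`) and `s-forth` (for `∃`): `back`, resp. `forth`, both with
`B` and with the inverse of `B` at the ends of the paths. -/
def SpecialStepCond {m : ℕ} (Q : Quant) (S : Fin (m + 1) → ℕ) (A B : BiRel U₁ U₂) : Prop :=
  StepCond Θ Q S A B ∧ StepCond Θ Q S A B.inv

open Classical in
/-- The operation `[f]` on sets of relations. -/
noncomputable def boolOp {k : ℕ} {U₁ U₂ : Type*} (f : (Fin k → Bool) → Bool)
    (β : Set (BiRel U₁ U₂)) : Set (BiRel U₁ U₂) :=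
  if IsConstantFn f then Set.univ
  else if Monotone f then β
  else if Antitone f then BiRel.inv '' β
  else (fun A => A.inter A.inv) '' β

/-- The operation `[μ]`: a set of tuples `⟨A₁, …, A_{δ(μ)+1}⟩` of relations. -/
def connOp {k : ℕ} (β : Set (BiRel U₁ U₂)) :
    (μ : PreConn k) → Set (Fin (μ.degree + 1) → BiRel U₁ U₂)
  | .core b => {A | A 0 ∈ boolOp b.eval β}
  | .guard Q m S μ => {A : Fin (μ.degree + 1 + 1) → BiRel U₁ U₂ |
      ((PreConn.guard Q m S μ).IsSpecial →
        A (Fin.last μ.degree).castSucc ∈ β ∧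
          SpecialStepCond Θ Q S (A (Fin.last _)) (A (Fin.last μ.degree).castSucc)) ∧
      (¬ (PreConn.guard Q m S μ).IsSpecial →
        Fin.init A ∈ connOp β μ ∧
          StepCond Θ Q S (A (Fin.last _)) (A (Fin.last μ.degree).castSucc))}

/-- `φ(x)` is invariant with respect to `A`: its truth is carried along `A`, from `U₁` to `U₂`
and from `U₂` to `U₁`. -/
def InvariantUnder {Θ : Set ℕ} {U₁ U₂ : Type*} [(corrLang Θ).Structure U₁]
    [(corrLang Θ).Structure U₂] (φ : CorrFormula Θ) (A : BiRel U₁ U₂) : Prop :=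
  (∀ a b, A.fwd a b → TrueAt a φ → TrueAt b φ) ∧ (∀ b a, A.bwd b a → TrueAt b φ → TrueAt a φ)

/-- `A` is an asimulation between two models, for the fragment generated by `𝕄`. -/
def IsAsimulation (𝕄 : Set Conn) (A : BiRel U₁ U₂) : Prop :=
  A.IsNonempty ∧ (∀ n : Θ, InvariantUnder (atomP n) A) ∧
    ∀ μ ∈ 𝕄, ∃ t ∈ connOp Θ {A} μ.2, t (Fin.last _) = A

end

universe u

/-- Invariance with respect to all asimulations between models over `Θ`. -/
def InvariantUnderAsimulations {Θ : Set ℕ} (𝕄 : Set Conn) (φ : CorrFormula Θ) : Prop :=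
  ∀ (U₁ U₂ : Type u) [Nonempty U₁] [Nonempty U₂] [(corrLang Θ).Structure U₁]
    [(corrLang Θ).Structure U₂] (A : BiRel U₁ U₂),
    IsAsimulation Θ 𝕄 A → InvariantUnder φ A

/-! Soundness is an induction on fragment formulas. The witnessing tuple of a connective passes
invariance from its arguments through one quantifier block after another. At a special connective
the two step conditions squeeze a truth vector between two others, and the absence of a TFT (or FTF)
chain forbids the bad value in the middle.

For the converse, let `F` be the set of formulas equivalent to one of the fragment; it is a lattice
of formulas. If `φ ∉ F`, compactness gives `a ⊨ φ` and `b ⊭ φ` such that every formula of `F` true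
at `a` is true at `b`, in models saturated along paths
(`IsLatticeClosed.exists_pathSaturated_of_not_mem`). It remains to see that inclusion of
`F`-theories is an asimulation between such models (`isAsimulation_inclusionRel`); then `φ` is not
invariant.

All intermediate relations are again inclusions of theories, for other sets of formulas. By
saturation, the step from `G` to `H` holds as soon as quantifying a finite disjunction (for `∀`) or
conjunction (for `∃`) of members of `H` gives a member of `G` (`stepCond_inclusionRel`). So
everything reduces to which formulas a core `b` produces from `F`: a core that is not antitone
yields every `θ`, one that is not monotone every `¬θ`, a TFT one every `θ ∨ ¬χ`, an FTF one every `θ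
∧ ¬χ`. These are exactly the finite joins that the definition of `[μ]` calls for. In degree 2 the
inner quantifier must absorb the joins required by the outer one. It does so because `∃` distributes
over `∨` and `∀` over `∧`, and because a weakly special core makes `boolSpan` closed under that
join; this is the role of regularity. -/

open FirstOrder

/-! ### Semantics of the connectives -/

section Semantics

variable {Θ : Set ℕ} {U : Type*} [(corrLang Θ).Structure U]

@[simp]
theorem trueAt_not {a : U} {φ : CorrFormula Θ} : TrueAt a φ.not ↔ ¬ TrueAt a φ :=
  Language.Formula.realize_not

@[simp]
theorem trueAt_inf {a : U} {φ ψ : CorrFormula Θ} :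
    TrueAt a (φ ⊓ ψ) ↔ TrueAt a φ ∧ TrueAt a ψ :=
  Language.Formula.realize_inf

@[simp]
theorem trueAt_sup {a : U} {φ ψ : CorrFormula Θ} :
    TrueAt a (φ ⊔ ψ) ↔ TrueAt a φ ∨ TrueAt a ψ :=
  Language.Formula.realize_sup

@[simp]
theorem trueAt_top {a : U} : TrueAt a (⊤ : CorrFormula Θ) ↔ True :=
  Language.Formula.realize_top

@[simp]
theorem trueAt_bot {a : U} : TrueAt a (⊥ : CorrFormula Θ) ↔ False :=
  Language.Formula.realize_bot

theorem trueAt_atomP {a : U} {n : Θ} :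
    TrueAt a (atomP n) ↔ Language.Structure.RelMap (symP n) ![a] :=
  Language.Formula.realize_rel₁

open Classical in
/-- The truth values at `a` of a tuple of formulas. -/
noncomputable def truthValues {k : ℕ} (ψ : Fin k → CorrFormula Θ) (a : U) : Fin k → Bool :=
  fun i => decide (TrueAt a (ψ i))

@[simp]
theorem truthValues_eq_true {k : ℕ} {ψ : Fin k → CorrFormula Θ} {a : U} {i : Fin k} :
    truthValues ψ a i = true ↔ TrueAt a (ψ i) := by
  simp [truthValues]

theorem truthValues_le {V : Type*} [(corrLang Θ).Structure V] {k : ℕ}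
    {ψ : Fin k → CorrFormula Θ} {a : U} {b : V} (h : ∀ i, TrueAt a (ψ i) → TrueAt b (ψ i)) :
    truthValues ψ a ≤ truthValues ψ b := by
  intro i
  rw [Bool.le_iff_imp]
  simpa using h i

theorem trueAt_boolComb {k : ℕ} (b : BoolComb k) (ψ : Fin k → CorrFormula Θ) (a : U) :
    TrueAt a (b.apply ψ) ↔ b.eval (truthValues ψ a) = true := by
  induction b with
  | atom i => simp [BoolComb.apply, BoolComb.eval]
  | top => simp [BoolComb.apply, BoolComb.eval]
  | bot => simp [BoolComb.apply, BoolComb.eval]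
  | neg b ih => simp [BoolComb.apply, BoolComb.eval, ih]
  | and b c ihb ihc => simp [BoolComb.apply, BoolComb.eval, ihb, ihc]
  | or b c ihb ihc => simp [BoolComb.apply, BoolComb.eval, ihb, ihc]

theorem realize_pathVar {m : ℕ} (a : U) (xs : Fin m → U) (i : Fin (m + 1)) :
    (pathVar (Θ := Θ) m i).realize (Sum.elim (fun _ => a) xs) =
      (Fin.cons a xs : Fin (m + 1) → U) i := by
  induction i using Fin.cases <;> simp [pathVar]

theorem realize_pathFormula {m : ℕ} (S : Fin (m + 1) → ℕ) (a : U) (xs : Fin (m + 1) → U) :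
    (pathFormula (Θ := Θ) S).Realize (fun _ => a) xs ↔
      IsPath Θ S (Fin.cons a xs : Fin (m + 2) → U) := by
  simp [pathFormula, IsPath, Language.BoundedFormula.realize_iInf,
    Language.BoundedFormula.realize_rel₂, realize_pathVar]

theorem realize_atLast {m : ℕ} (ψ : CorrFormula Θ) (a : U) (xs : Fin (m + 1) → U) :
    (atLast m ψ).Realize (fun _ => a) xs ↔ TrueAt (xs (Fin.last m)) ψ := by
  unfold atLast TrueAt Language.Formula.Realize
  erw [Language.BoundedFormula.realize_relabel]
  rw [iff_eq_eq]
  -- The two sides differ only in the assignment to the remaining bound variables, of which there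
  -- are none.
  exact congr rfl (Subsingleton.elim _ _)

theorem trueAt_guardFormula_all {m : ℕ} {S : Fin (m + 1) → ℕ} {ψ : CorrFormula Θ} {a : U} :
    TrueAt a (guardFormula .all S ψ) ↔
      ∀ c : Fin (m + 2) → U, c 0 = a → IsPath Θ S c → TrueAt (c (Fin.last _)) ψ := by
  simp only [TrueAt, guardFormula, Language.BoundedFormula.realize_alls,
    Language.BoundedFormula.realize_imp]
  constructor
  · rintro h c rfl hc
    have := h (Fin.tail c)
    rw [realize_pathFormula, realize_atLast, Fin.cons_self_tail] at this
    exact this hc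
  · intro h xs
    rw [realize_pathFormula, realize_atLast]
    intro hc
    exact h _ rfl hc

theorem trueAt_guardFormula_ex {m : ℕ} {S : Fin (m + 1) → ℕ} {ψ : CorrFormula Θ} {a : U} :
    TrueAt a (guardFormula .ex S ψ) ↔
      ∃ c : Fin (m + 2) → U, c 0 = a ∧ IsPath Θ S c ∧ TrueAt (c (Fin.last _)) ψ := by
  simp only [TrueAt, guardFormula, Language.BoundedFormula.realize_exs,
    Language.BoundedFormula.realize_inf]
  constructor
  · rintro ⟨xs, h⟩
    rw [realize_pathFormula, realize_atLast] at h
    exact ⟨_, rfl, h⟩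
  · rintro ⟨c, rfl, hc⟩
    refine ⟨Fin.tail c, ?_⟩
    rw [realize_pathFormula, realize_atLast, Fin.cons_self_tail]
    exact hc

end Semantics

/-- Two vocabularies are allowed because equivalence of connectives is defined over the full one,
whereas their applications live over `Θ`. -/
theorem trueAt_guardFormula_congr {Θ Θ' : Set ℕ} {U : Type*} [(corrLang Θ).Structure U]
    [(corrLang Θ').Structure U]
    (hR : ∀ {m : ℕ} (S : Fin (m + 1) → ℕ) (c : Fin (m + 2) → U), IsPath Θ S c ↔ IsPath Θ' S c)
    {χ : CorrFormula Θ} {χ' : CorrFormula Θ'} (h : ∀ a : U, TrueAt a χ ↔ TrueAt a χ')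
    (Q : Quant) {m : ℕ} (S : Fin (m + 1) → ℕ) (a : U) :
    TrueAt a (guardFormula Q S χ) ↔ TrueAt a (guardFormula Q S χ') := by
  cases Q
  · simp only [trueAt_guardFormula_all, hR, h]
  · simp only [trueAt_guardFormula_ex, hR, h]

/-- The truth set of `μ(ψ₁, …, ψ_k)` depends only on the binary relations and on the truth sets
of the `ψᵢ`. -/
theorem trueAt_apply_congr {Θ Θ' : Set ℕ} {U : Type*} [(corrLang Θ).Structure U]
    [(corrLang Θ').Structure U]
    (hR : ∀ {m : ℕ} (S : Fin (m + 1) → ℕ) (c : Fin (m + 2) → U), IsPath Θ S c ↔ IsPath Θ' S c)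
    {k : ℕ} {ψ : Fin k → CorrFormula Θ} {ψ' : Fin k → CorrFormula Θ'}
    (h : ∀ i (a : U), TrueAt a (ψ i) ↔ TrueAt a (ψ' i)) (μ : PreConn k) (a : U) :
    TrueAt a (μ.apply ψ) ↔ TrueAt a (μ.apply ψ') := by
  induction μ generalizing a with
  | core b =>
    have : truthValues ψ a = truthValues ψ' a := by
      funext i
      rw [Bool.eq_iff_iff]
      simpa using h i a
    simp [PreConn.apply, trueAt_boolComb, this]
  | guard Q m S μ ih => exact trueAt_guardFormula_congr hR ih Q S a

/-! ### Logical equivalence -/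

section Equivalence

variable {Θ : Set ℕ}

theorem trueAt_iff_of_iff {φ ψ : CorrFormula Θ} (h : (∅ : (corrLang Θ).Theory).Iff φ ψ)
    {U : Type*} [(corrLang Θ).Structure U] (a : U) : TrueAt a φ ↔ TrueAt a ψ :=
  haveI : Nonempty U := ⟨a⟩
  h.realize_iff

/-- Logical equivalence may be tested on the models in any fixed universe. -/
theorem iff_of_forall_trueAt_iff {φ ψ : CorrFormula Θ}
    (h : ∀ (U : Type u) [(corrLang Θ).Structure U] (a : U), TrueAt a φ ↔ TrueAt a ψ) :
    (∅ : (corrLang Θ).Theory).Iff φ ψ := by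
  refine Language.Theory.models_formula_iff.2 fun M v => ?_
  -- Logical equivalence quantifies over models in `Type`; such a model is copied into universe `u`.
  let : (corrLang Θ).Structure (ULift.{u} M) := Equiv.inducedStructure Equiv.ulift.symm
  let e : M ≃[corrLang Θ] ULift.{u} M := Equiv.inducedStructureEquiv Equiv.ulift.symm
  have key : ∀ χ : CorrFormula Θ, TrueAt (e (v ())) χ ↔ χ.Realize v := fun χ =>
    Language.StrongHomClass.realize_formula e χ
  rw [Language.Formula.realize_iff, ← key, ← key]
  exact h _ _

/-- Equivalent connectives have equivalent applications. -/
theorem apply_iff_of_equivalent {k : ℕ} {μ ν : PreConn k} (h : μ.Equivalent ν)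
    (ψ : Fin k → CorrFormula Θ) :
    (∅ : (corrLang Θ).Theory).Iff (μ.apply ψ) (ν.apply ψ) := by
  refine iff_of_forall_trueAt_iff.{0} fun U inst a => ?_
  -- Interpreting `P i` as the truth set of `ψ i` turns substitution into evaluation of the
  -- connective itself. Letters with index at least `k` are empty.
  let I : (corrLang Set.univ).Structure U :=
    { funMap := fun f => f.elim
      RelMap := fun {_} r => match r with
        | .P n => fun x => ∃ i : Fin k, (i : ℕ) = n ∧ @TrueAt Θ U inst (x 0) (ψ i)
        | .R i => fun x => @Language.Structure.RelMap _ U inst _ (symR i) x }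
  have hP : ∀ (i : Fin k) (a : U), @TrueAt Θ U inst a (ψ i) ↔
      @TrueAt Set.univ U I a (atomP ⟨i, Set.mem_univ _⟩) := by
    intro i a
    rw [@trueAt_atomP _ _ I]
    refine ⟨fun h => ⟨i, rfl, h⟩, ?_⟩
    rintro ⟨j, hj, h⟩
    obtain rfl := Fin.ext hj
    exact h
  have key : ∀ μ : PreConn k, @TrueAt Θ U inst a (μ.apply ψ) ↔
      @TrueAt Set.univ U I a μ.toFormula := fun μ =>
    @trueAt_apply_congr Θ Set.univ U inst I (fun _ _ => Iff.rfl) k _ _ hP μ a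
  rw [key, key]
  exact @trueAt_iff_of_iff _ _ _ h U I a

end Equivalence

/-! ### Formulas of the fragment are invariant -/

section Invariance

variable {Θ : Set ℕ} {U₁ U₂ : Type*} [(corrLang Θ).Structure U₁] [(corrLang Θ).Structure U₂]

/-- Truth of `φ` is carried along `A`. -/
def Preserves {U V : Type*} [(corrLang Θ).Structure U] [(corrLang Θ).Structure V]
    (φ : CorrFormula Θ) (A : U → V → Prop) : Prop :=
  ∀ a b, A a b → TrueAt a φ → TrueAt b φ

section OneDirection

variable {U V : Type*} [(corrLang Θ).Structure U] [(corrLang Θ).Structure V] {m : ℕ}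
  {S : Fin (m + 1) → ℕ} {A B : U → V → Prop} {χ : CorrFormula Θ}

theorem Back.preserves (h : Back Θ S A B) (hχ : Preserves χ B) :
    Preserves (guardFormula .all S χ) A := by
  intro a b hab ha
  rw [trueAt_guardFormula_all] at ha ⊢
  rintro c rfl hc
  obtain ⟨d, rfl, hd, hdc⟩ := h a c hab hc
  exact hχ _ _ hdc (ha d rfl hd)

theorem Forth.preserves (h : Forth Θ S A B) (hχ : Preserves χ B) :
    Preserves (guardFormula .ex S χ) A := by
  intro a b hab ha
  rw [trueAt_guardFormula_ex] at ha ⊢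
  obtain ⟨c, rfl, hc, hχc⟩ := ha
  obtain ⟨d, rfl, hd, hdc⟩ := h c b hab hc
  exact ⟨d, rfl, hd, hχ _ _ hdc hχc⟩

variable {k : ℕ} {b : BoolComb k} {ψ : Fin k → CorrFormula Θ} {B' : U → V → Prop}

/-- Pulling a path ending at `c` back along `B` and along `B'` gives ends `d` and `e` whose truth
vectors lie below and above that of `c`. If the core failed at `c` while holding at `d` and `e`,
these three vectors would form a TFT chain. -/
theorem Back.preserves_of_not_isTFT (h : Back Θ S A B) (h' : Back Θ S A B')
    (hb : ¬ IsTFT b.eval) (hψ : ∀ i, Preserves (ψ i) B)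
    (hψ' : ∀ i c d, B' c d → TrueAt d (ψ i) → TrueAt c (ψ i)) :
    Preserves (guardFormula .all S (b.apply ψ)) A := by
  intro a₁ b₁ hab ha
  rw [trueAt_guardFormula_all] at ha ⊢
  rintro c rfl hc
  obtain ⟨d, rfl, hd, hdc⟩ := h a₁ c hab hc
  obtain ⟨e, he0, he, hec⟩ := h' _ c hab hc
  have h1 := (trueAt_boolComb b ψ _).1 (ha d rfl hd)
  have h2 := (trueAt_boolComb b ψ _).1 (ha e he0 he)
  rw [trueAt_boolComb]
  by_contra h3
  rw [Bool.not_eq_true] at h3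
  refine hb ⟨_, _, _, lt_of_le_of_ne (truthValues_le fun i => hψ i _ _ hdc) ?_,
    lt_of_le_of_ne (truthValues_le fun i => hψ' i _ _ hec) ?_, h1, h3, h2⟩
  · intro hh; simp [hh, h3] at h1
  · intro hh; simp [← hh, h3] at h2

theorem Forth.preserves_of_not_isFTF (h : Forth Θ S A B) (h' : Forth Θ S A B')
    (hb : ¬ IsFTF b.eval) (hψ : ∀ i, Preserves (ψ i) B)
    (hψ' : ∀ i c d, B' c d → TrueAt d (ψ i) → TrueAt c (ψ i)) :
    Preserves (guardFormula .ex S (b.apply ψ)) A := by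
  intro a₁ b₁ hab ha
  rw [trueAt_guardFormula_ex] at ha
  obtain ⟨c, rfl, hc, hχ⟩ := ha
  obtain ⟨d, rfl, hd, hcd⟩ := h c b₁ hab hc
  obtain ⟨e, he0, he, hce⟩ := h' c _ hab hc
  by_contra hcon
  simp only [trueAt_guardFormula_ex, not_exists, not_and, trueAt_boolComb,
    Bool.not_eq_true] at hcon
  rw [trueAt_boolComb] at hχ
  have h1 := hcon d rfl hd
  have h2 := hcon e he0 he
  refine hb ⟨_, _, _, lt_of_le_of_ne (truthValues_le fun i => hψ' i _ _ hce) ?_,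
    lt_of_le_of_ne (truthValues_le fun i => hψ i _ _ hcd) ?_, h2, hχ, h1⟩
  · intro hh; simp [hh, hχ] at h2
  · intro hh; simp [← hh, hχ] at h1

end OneDirection

theorem invariantUnder_boolComb {k : ℕ} {b : BoolComb k} {ψ : Fin k → CorrFormula Θ}
    {A B : BiRel U₁ U₂} (hψ : ∀ i, InvariantUnder (ψ i) A) (hB : B ∈ boolOp b.eval {A}) :
    InvariantUnder (b.apply ψ) B := by
  have h1 : ∀ {a c}, A.fwd a c → truthValues ψ a ≤ truthValues ψ c :=
    fun h => truthValues_le fun i => (hψ i).1 _ _ h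
  have h2 : ∀ {a c}, A.bwd a c → truthValues ψ a ≤ truthValues ψ c :=
    fun h => truthValues_le fun i => (hψ i).2 _ _ h
  simp only [InvariantUnder, trueAt_boolComb]
  unfold boolOp at hB
  split_ifs at hB with hc hm ha
  · exact ⟨fun _ _ _ h => hc _ _ ▸ h, fun _ _ _ h => hc _ _ ▸ h⟩
  · obtain rfl := hB
    exact ⟨fun _ _ h => Bool.le_iff_imp.1 (hm (h1 h)), fun _ _ h => Bool.le_iff_imp.1 (hm (h2 h))⟩
  · obtain ⟨_, rfl, rfl⟩ := hB
    exact ⟨fun _ _ h => Bool.le_iff_imp.1 (ha (h2 h)), fun _ _ h => Bool.le_iff_imp.1 (ha (h1 h))⟩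
  · obtain ⟨_, rfl, rfl⟩ := hB
    -- For a rest function, points related by `A ∩ A⁻¹` have equal truth vectors.
    refine ⟨fun _ _ h => ?_, fun _ _ h => ?_⟩
    · rw [le_antisymm (h1 h.1) (h2 h.2)]; exact id
    · rw [le_antisymm (h2 h.1) (h1 h.2)]; exact id

theorem StepCond.invariantUnder {m : ℕ} {Q : Quant} {S : Fin (m + 1) → ℕ} {A B : BiRel U₁ U₂}
    {χ : CorrFormula Θ} (h : StepCond Θ Q S A B) (hχ : InvariantUnder χ B) :
    InvariantUnder (guardFormula Q S χ) A := by
  cases Q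
  · exact ⟨h.1.preserves hχ.1, h.2.preserves hχ.2⟩
  · exact ⟨h.1.preserves hχ.1, h.2.preserves hχ.2⟩

theorem SpecialStepCond.invariantUnder {m k : ℕ} {Q : Quant} {S : Fin (m + 1) → ℕ}
    {A B : BiRel U₁ U₂} {b : BoolComb k} {ψ : Fin k → CorrFormula Θ}
    (h : SpecialStepCond Θ Q S A B) (hb : WeaklySpecialFn Q b.eval)
    (hψ : ∀ i, InvariantUnder (ψ i) B) :
    InvariantUnder (guardFormula Q S (b.apply ψ)) A := by
  have h1 i := (hψ i).1
  have h2 i := (hψ i).2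
  cases Q
  · exact ⟨h.1.1.preserves_of_not_isTFT h.2.1 hb h1 fun i _ _ => h2 i _ _,
      h.1.2.preserves_of_not_isTFT h.2.2 hb h2 fun i _ _ => h1 i _ _⟩
  · exact ⟨h.1.1.preserves_of_not_isFTF h.2.1 hb h1 fun i _ _ => h2 i _ _,
      h.1.2.preserves_of_not_isFTF h.2.2 hb h2 fun i _ _ => h1 i _ _⟩

theorem invariantUnder_apply {k : ℕ} {μ : PreConn k} {ψ : Fin k → CorrFormula Θ}
    {A : BiRel U₁ U₂} (hψ : ∀ i, InvariantUnder (ψ i) A)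
    {t : Fin (μ.degree + 1) → BiRel U₁ U₂} (ht : t ∈ connOp Θ {A} μ) :
    InvariantUnder (μ.apply ψ) (t (Fin.last _)) := by
  induction μ with
  | core b => exact invariantUnder_boolComb hψ ht
  | guard Q m S μ ih =>
    by_cases hs : (PreConn.guard Q m S μ).IsSpecial
    · obtain ⟨hA, hstep⟩ := ht.1 hs
      rw [Set.mem_singleton_iff.1 hA] at hstep
      cases μ with
      | core b => exact hstep.invariantUnder hs.2 hψ
      | guard => exact hs.elim
    · obtain ⟨hinit, hstep⟩ := ht.2 hs
      exact hstep.invariantUnder (ih hinit)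

theorem Fragment.invariantUnder {𝕄 : Set Conn} {φ : CorrFormula Θ} (hφ : Fragment Θ 𝕄 φ)
    {A : BiRel U₁ U₂} (hA : IsAsimulation Θ 𝕄 A) : InvariantUnder φ A := by
  induction hφ with
  | atom n => exact hA.2.1 n
  | app μ hμ ψ _ ih =>
    obtain ⟨t, ht, rfl⟩ := hA.2.2 μ hμ
    exact invariantUnder_apply ih ht

end Invariance

/-! ### Finite conjunctions and disjunctions -/

section Join

variable {Θ : Set ℕ} {U : Type*} [(corrLang Θ).Structure U]

/-- The disjunction of a list of formulas for `∀`, their conjunction for `∃`. -/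
def listJoin : Quant → List (CorrFormula Θ) → CorrFormula Θ
  | .all, l => l.foldr (· ⊔ ·) ⊥
  | .ex, l => l.foldr (· ⊓ ·) ⊤

theorem trueAt_listJoin_all {l : List (CorrFormula Θ)} {a : U} :
    TrueAt a (listJoin .all l) ↔ ∃ θ ∈ l, TrueAt a θ := by
  induction l with
  | nil => simp [listJoin]
  | cons θ l ih => simp_all [listJoin]

theorem trueAt_listJoin_ex {l : List (CorrFormula Θ)} {a : U} :
    TrueAt a (listJoin .ex l) ↔ ∀ θ ∈ l, TrueAt a θ := by
  induction l with
  | nil => simp [listJoin]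
  | cons θ l ih => simp_all [listJoin]

end Join

/-! ### Ultraproducts over `ℕ` -/

/-- Supplies finite approximations to a countable set of formulas: the `n`-th factor of an
ultraproduct has to satisfy only those listed in `l n`. -/
theorem exists_seq_list_eventually_mem (ι : Type*) [Countable ι] :
    ∃ l : ℕ → List ι, ∀ i, ∀ᶠ n in Filter.atTop, i ∈ l n := by
  obtain ⟨_⟩ := nonempty_encodable ι
  refine ⟨fun n => (List.range n).filterMap Encodable.decode, fun i => ?_⟩
  filter_upwards [Filter.eventually_gt_atTop (Encodable.encode i)] with n hn
  exact List.mem_filterMap.2 ⟨_, List.mem_range.2 hn, Encodable.encodek i⟩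

/-- Along paths, a countable set of formulas is realized as soon as its finite subsets are. -/
def PathSaturated (Θ : Set ℕ) (U : Type*) [(corrLang Θ).Structure U] : Prop :=
  ∀ {m : ℕ} (S : Fin (m + 1) → ℕ) (a : U) {ι : Type} [Countable ι] (γ : ι → CorrFormula Θ),
    (∀ l : List ι, ∃ c : Fin (m + 2) → U, c 0 = a ∧ IsPath Θ S c ∧
      ∀ i ∈ l, TrueAt (c (Fin.last _)) (γ i)) →
    ∃ c : Fin (m + 2) → U, c 0 = a ∧ IsPath Θ S c ∧ ∀ i, TrueAt (c (Fin.last _)) (γ i)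

section Ultraproduct

variable {Θ : Set ℕ} {M : ℕ → Type u} [∀ n, (corrLang Θ).Structure (M n)] [∀ n, Nonempty (M n)]

/-- The ultraproduct of a sequence of models along a fixed non-principal ultrafilter. -/
abbrev SeqProduct (M : ℕ → Type u) : Type u :=
  ((Filter.hyperfilter ℕ : Ultrafilter ℕ) : Filter ℕ).Product M

/-- The element of the ultraproduct given by a sequence. -/
noncomputable def SeqProduct.mk (x : ∀ n, M n) : SeqProduct M := Quotient.mk'' x

theorem trueAt_seqProduct_mk {x : ∀ n, M n} {φ : CorrFormula Θ} :
    TrueAt (SeqProduct.mk x) φ ↔ ∀ᶠ n in Filter.hyperfilter ℕ, TrueAt (x n) φ :=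
  Language.Ultraproduct.realize_formula_cast φ fun _ => x

theorem relMap_seqProduct_mk {x y : ∀ n, M n} {i : ℕ} :
    Language.Structure.RelMap (symR (Θ := Θ) i) ![SeqProduct.mk x, SeqProduct.mk y] ↔
      ∀ᶠ n in Filter.hyperfilter ℕ,
        Language.Structure.RelMap (symR (Θ := Θ) i) ![x n, y n] := by
  have := Language.Ultraproduct.realize_formula_cast (u := Filter.hyperfilter ℕ) (M := M)
    (Language.Relations.formula₂ (symR (Θ := Θ) i) (.var (0 : Fin 2)) (.var (1 : Fin 2))) ![x, y]
  simpa only [Language.Formula.realize_rel₂] using! this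

theorem isPath_seqProduct_mk {m : ℕ} {S : Fin (m + 1) → ℕ} {c : Fin (m + 2) → ∀ n, M n} :
    IsPath Θ S (fun j => SeqProduct.mk (c j)) ↔
      ∀ᶠ n in Filter.hyperfilter ℕ, IsPath Θ S fun j => c j n := by
  simp only [IsPath, relMap_seqProduct_mk, Filter.eventually_all]

/-- A diagonal argument. By Łoś's theorem each finite stage `l k` is realized along a path in almost
all factors; in factor `n` the path is chosen for the latest stage `k ≤ n` realized there, and these
stages eventually pass every bound. -/
theorem pathSaturated_seqProduct : PathSaturated Θ (SeqProduct M) := by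
  classical
  intro m S a ι _ γ h
  obtain ⟨x, rfl⟩ := Quotient.exists_rep a
  obtain ⟨l, hl⟩ := exists_seq_list_eventually_mem ι
  let X : ℕ → ℕ → Prop := fun k n => ∃ c : Fin (m + 2) → M n, c 0 = x n ∧ IsPath Θ S c ∧
    ∀ i ∈ l k, TrueAt (c (Fin.last _)) (γ i)
  have hX : ∀ k, ∀ᶠ n in Filter.hyperfilter ℕ, X k n := by
    intro k
    have h1 : TrueAt (SeqProduct.mk x) (guardFormula .ex S (listJoin .ex ((l k).map γ))) := by
      rw [trueAt_guardFormula_ex]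
      simpa [trueAt_listJoin_ex] using! h (l k)
    rw [trueAt_seqProduct_mk] at h1
    simpa [trueAt_guardFormula_ex, trueAt_listJoin_ex] using h1
  -- `K n` defaults to `0` when no stage up to `n` is realized, so `X (K n) n` may fail. An
  -- arbitrary constant sequence then stands in for the path, on a negligible set of indices.
  let K : ℕ → ℕ := fun n => Nat.findGreatest (fun k => X k n) n
  have hc : ∀ n, ∃ c : Fin (m + 2) → M n, c 0 = x n ∧ (X (K n) n → IsPath Θ S c ∧
      ∀ i ∈ l (K n), TrueAt (c (Fin.last _)) (γ i)) := by
    intro n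
    by_cases hn : X (K n) n
    · obtain ⟨c, h0, hc⟩ := hn
      exact ⟨c, h0, fun _ => hc⟩
    · exact ⟨fun _ => x n, rfl, fun h => (hn h).elim⟩
  choose c hc0 hc using hc
  have hlarge : ∀ k, ∀ᶠ n in Filter.hyperfilter ℕ, k ≤ K n ∧ X (K n) n := by
    intro k
    filter_upwards [hX k, Nat.hyperfilter_le_atTop (Filter.eventually_ge_atTop k)] with n hn hkn
    exact ⟨Nat.le_findGreatest hkn hn, Nat.findGreatest_spec (P := fun k => X k n) hkn hn⟩
  refine ⟨fun j => SeqProduct.mk fun n => c n j, ?_, ?_, fun i => ?_⟩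
  · exact congrArg SeqProduct.mk (funext hc0)
  · rw [isPath_seqProduct_mk]
    filter_upwards [hlarge 0] with n hn
    exact (hc n hn.2).1
  · obtain ⟨k, hk⟩ := Filter.eventually_atTop.1 (hl i)
    rw [trueAt_seqProduct_mk]
    filter_upwards [hlarge k] with n hn
    exact (hc n hn.2).2 i (hk _ hn.1)

end Ultraproduct

/-- Compactness, with a saturated model. -/
theorem exists_pathSaturated_of_finitely_satisfiable {Θ : Set ℕ} {ι : Type} [Countable ι]
    (γ : ι → CorrFormula Θ)
    (h : ∀ l : List ι, ∃ (U : Type u) (_ : (corrLang Θ).Structure U) (a : U),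
      ∀ i ∈ l, TrueAt a (γ i)) :
    ∃ (U : Type u) (_ : (corrLang Θ).Structure U) (a : U),
      PathSaturated Θ U ∧ ∀ i, TrueAt a (γ i) := by
  obtain ⟨l, hl⟩ := exists_seq_list_eventually_mem ι
  choose U str a ha using fun n => h (l n)
  have : ∀ n, Nonempty (U n) := fun n => ⟨a n⟩
  refine ⟨SeqProduct U, inferInstance, SeqProduct.mk a, pathSaturated_seqProduct, fun i => ?_⟩
  rw [trueAt_seqProduct_mk]
  filter_upwards [Nat.hyperfilter_le_atTop (hl i)] with n hn
  exact ha n i hn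

/-- Countability of the language is what makes ultraproducts over `ℕ` sufficiently saturated. -/
instance countable_corrFormula {Θ : Set ℕ} : Countable (CorrFormula Θ) := by
  have hR : Countable (Σ n, (corrLang Θ).Relations n) := by
    refine Function.Surjective.countable (α := Θ ⊕ ℕ)
      (f := Sum.elim (fun n => ⟨1, symP n⟩) fun i => ⟨2, symR i⟩) ?_
    rintro ⟨_, n | i⟩
    · exact ⟨.inl n, rfl⟩
    · exact ⟨.inr i, rfl⟩
  have hF : Countable (Σ n, (corrLang Θ).Functions n) :=
    have : IsEmpty (Σ n, (corrLang Θ).Functions n) := ⟨fun f => f.2.elim⟩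
    inferInstance
  infer_instance

/-! ### Relations given by inclusion of theories -/

section InclusionRel

variable {Θ : Set ℕ} {U₁ U₂ : Type*} [(corrLang Θ).Structure U₁] [(corrLang Θ).Structure U₂]

/-- `a` is related to `b` if all formulas of `G` true at `a` are true at `b`. -/
def inclusionRel (U₁ U₂ : Type*) [(corrLang Θ).Structure U₁] [(corrLang Θ).Structure U₂]
    (G : Set (CorrFormula Θ)) : BiRel U₁ U₂ :=
  ⟨fun a b => ∀ θ ∈ G, TrueAt a θ → TrueAt b θ, fun b a => ∀ θ ∈ G, TrueAt b θ → TrueAt a θ⟩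

/-- By contraposition. Together with `inclusionRel_inter` it keeps the operations `[f]` within
relations given by inclusion of theories. -/
theorem inclusionRel_inv (G : Set (CorrFormula Θ)) :
    (inclusionRel U₁ U₂ G).inv = inclusionRel U₁ U₂ (Language.Formula.not '' G) := by
  ext a b <;> simp [inclusionRel, BiRel.inv, not_imp_not]

theorem inclusionRel_inter (G H : Set (CorrFormula Θ)) :
    (inclusionRel U₁ U₂ G).inter (inclusionRel U₁ U₂ H) = inclusionRel U₁ U₂ (G ∪ H) := by
  ext a b <;> simp [inclusionRel, BiRel.inter, or_imp, forall_and]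

section OneDirection

variable {U V : Type*} [(corrLang Θ).Structure U] [(corrLang Θ).Structure V] {m : ℕ}
  {S : Fin (m + 1) → ℕ} {G H : Set (CorrFormula Θ)}

/-- A path from `a` is needed whose end falsifies every `H`-formula false at the end of `b`. For
finitely many of them, their guarded disjunction is false at `b 0`, hence at `a`, which gives such a
path; saturation handles all at once. -/
theorem back_inclusion (hU : PathSaturated Θ U)
    (h : ∀ l : List (CorrFormula Θ), (∀ θ ∈ l, θ ∈ H) → guardFormula .all S (listJoin .all l) ∈ G) :
    Back Θ S (fun (a : U) (b : V) => ∀ θ ∈ G, TrueAt a θ → TrueAt b θ)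
      (fun a b => ∀ θ ∈ H, TrueAt a θ → TrueAt b θ) := by
  intro a b hab hb
  obtain ⟨c, h0, hc, hγ⟩ := hU S a
    (fun θ : {θ // θ ∈ H ∧ ¬ TrueAt (b (Fin.last _)) θ} => θ.1.not) (by
      intro l
      have hl := hab _ (h (l.map Subtype.val) (by simp +contextual))
      have hb' : ¬ TrueAt (b 0) (guardFormula .all S (listJoin .all (l.map Subtype.val))) := by
        intro hcon
        have := trueAt_guardFormula_all.1 hcon b rfl hb
        obtain ⟨θ, hθ, hbθ⟩ := trueAt_listJoin_all.1 this
        obtain ⟨i, -, rfl⟩ := List.mem_map.1 hθ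
        exact i.2.2 hbθ
      have ha := mt hl hb'
      rw [trueAt_guardFormula_all] at ha
      push Not at ha
      obtain ⟨c, h0, hc, hlast⟩ := ha
      refine ⟨c, h0, hc, fun i hi => ?_⟩
      rw [trueAt_not]
      exact fun hi' => hlast (trueAt_listJoin_all.2 ⟨_, List.mem_map_of_mem hi, hi'⟩))
  refine ⟨c, h0, hc, fun θ hθ => ?_⟩
  contrapose
  exact fun hb' => trueAt_not.1 (hγ ⟨θ, hθ, hb'⟩)

theorem forth_inclusion (hV : PathSaturated Θ V)
    (h : ∀ l : List (CorrFormula Θ), (∀ θ ∈ l, θ ∈ H) → guardFormula .ex S (listJoin .ex l) ∈ G) :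
    Forth Θ S (fun (a : U) (b : V) => ∀ θ ∈ G, TrueAt a θ → TrueAt b θ)
      (fun a b => ∀ θ ∈ H, TrueAt a θ → TrueAt b θ) := by
  intro a b hab ha
  obtain ⟨c, h0, hc, hγ⟩ := hV S b
    (fun θ : {θ // θ ∈ H ∧ TrueAt (a (Fin.last _)) θ} => θ.1) (by
      intro l
      have hl := hab _ (h (l.map Subtype.val) (by simp +contextual)) (by
        rw [trueAt_guardFormula_ex]
        exact ⟨a, rfl, ha, by simp +contextual [trueAt_listJoin_ex]⟩)
      obtain ⟨c, h0, hc, hlast⟩ := trueAt_guardFormula_ex.1 hl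
      exact ⟨c, h0, hc, fun i hi => trueAt_listJoin_ex.1 hlast _ (List.mem_map_of_mem hi)⟩)
  exact ⟨c, h0, hc, fun θ hθ h => hγ ⟨θ, hθ, h⟩⟩

end OneDirection

/-- The hypothesis includes the empty list, so the guarded `∀⊥` or `∃⊤` must belong to `G`. -/
theorem stepCond_inclusionRel (h₁ : PathSaturated Θ U₁) (h₂ : PathSaturated Θ U₂) {Q : Quant}
    {m : ℕ} {S : Fin (m + 1) → ℕ} {G H : Set (CorrFormula Θ)}
    (h : ∀ l : List (CorrFormula Θ), (∀ θ ∈ l, θ ∈ H) → guardFormula Q S (listJoin Q l) ∈ G) :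
    StepCond Θ Q S (inclusionRel U₁ U₂ G) (inclusionRel U₁ U₂ H) := by
  cases Q
  · exact ⟨back_inclusion h₁ h, back_inclusion h₂ h⟩
  · exact ⟨forth_inclusion h₂ h, forth_inclusion h₁ h⟩

end InclusionRel

/-! ### Sets of formulas closed under the lattice operations -/

section Closure

variable {Θ : Set ℕ}

/-- `F` is closed under logical equivalence and under `∧`, `∨`, `⊥`, `⊤`. -/
structure IsLatticeClosed (F : Set (CorrFormula Θ)) : Prop where
  congr {φ ψ : CorrFormula Θ} : φ ∈ F → φ ⇔[∅] ψ → ψ ∈ F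
  top : ⊤ ∈ F
  bot : ⊥ ∈ F
  inf {φ ψ : CorrFormula Θ} : φ ∈ F → ψ ∈ F → φ ⊓ ψ ∈ F
  sup {φ ψ : CorrFormula Θ} : φ ∈ F → ψ ∈ F → φ ⊔ ψ ∈ F

theorem listJoin_all_induction {P : CorrFormula Θ → Prop} (hbot : P ⊥)
    (hsup : ∀ φ ψ, P φ → P ψ → P (φ ⊔ ψ)) (l : List (CorrFormula Θ)) (hl : ∀ θ ∈ l, P θ) :
    P (listJoin .all l) := by
  induction l with
  | nil => exact hbot
  | cons θ l ih => exact hsup _ _ (hl θ (by simp)) (ih fun χ hχ => hl χ (by simp [hχ]))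

theorem listJoin_ex_induction {P : CorrFormula Θ → Prop} (htop : P ⊤)
    (hinf : ∀ φ ψ, P φ → P ψ → P (φ ⊓ ψ)) (l : List (CorrFormula Θ)) (hl : ∀ θ ∈ l, P θ) :
    P (listJoin .ex l) := by
  induction l with
  | nil => exact htop
  | cons θ l ih => exact hinf _ _ (hl θ (by simp)) (ih fun χ hχ => hl χ (by simp [hχ]))

theorem guardFormula_iff_congr {Q : Quant} {m : ℕ} {S : Fin (m + 1) → ℕ} {φ ψ : CorrFormula Θ}
    (h : φ ⇔[∅] ψ) : guardFormula Q S φ ⇔[∅] guardFormula Q S ψ :=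
  iff_of_forall_trueAt_iff.{0} fun _ _ a =>
    trueAt_guardFormula_congr (fun _ _ => Iff.rfl) (trueAt_iff_of_iff h) Q S a

namespace IsLatticeClosed

variable {F : Set (CorrFormula Θ)} (hF : IsLatticeClosed F)
include hF

theorem listJoin_mem (Q : Quant) (l : List (CorrFormula Θ)) (hl : ∀ θ ∈ l, θ ∈ F) :
    listJoin Q l ∈ F := by
  cases Q
  · exact listJoin_all_induction hF.bot (fun _ _ => hF.sup) l hl
  · exact listJoin_ex_induction hF.top (fun _ _ => hF.inf) l hl

theorem exists_listJoin_iff_not (Q : Quant) (l : List (CorrFormula Θ))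
    (hl : ∀ θ ∈ l, θ ∈ Language.Formula.not '' F) : ∃ θ ∈ F, listJoin Q l ⇔[∅] θ.not := by
  have hl' : ∀ φ ∈ l, ∃ θ ∈ F, φ ⇔[∅] θ.not := by
    intro φ hφ
    obtain ⟨θ, hθ, rfl⟩ := hl φ hφ
    exact ⟨θ, hθ, .refl _⟩
  cases Q
  · refine listJoin_all_induction (P := fun φ => ∃ θ ∈ F, φ ⇔[∅] θ.not) ⟨⊤, hF.top, ?_⟩ ?_ l hl'
    · exact iff_of_forall_trueAt_iff.{0} fun U _ a => by simp
    · rintro φ ψ ⟨θ, hθ, h⟩ ⟨χ, hχ, h'⟩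
      refine ⟨_, hF.inf hθ hχ, iff_of_forall_trueAt_iff.{0} fun U _ a => ?_⟩
      simp [trueAt_iff_of_iff h, trueAt_iff_of_iff h', imp_iff_not_or]
  · refine listJoin_ex_induction (P := fun φ => ∃ θ ∈ F, φ ⇔[∅] θ.not) ⟨⊥, hF.bot, ?_⟩ ?_ l hl'
    · exact iff_of_forall_trueAt_iff.{0} fun U _ a => by simp
    · rintro φ ψ ⟨θ, hθ, h⟩ ⟨χ, hχ, h'⟩
      refine ⟨_, hF.sup hθ hχ, iff_of_forall_trueAt_iff.{0} fun U _ a => ?_⟩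
      simp [trueAt_iff_of_iff h, trueAt_iff_of_iff h']

theorem exists_sup_not_iff_sup {φ ψ : CorrFormula Θ} (hφ : ∃ θ ∈ F, ∃ χ ∈ F, φ ⇔[∅] θ ⊔ χ.not)
    (hψ : ∃ θ ∈ F, ∃ χ ∈ F, ψ ⇔[∅] θ ⊔ χ.not) :
    ∃ θ ∈ F, ∃ χ ∈ F, φ ⊔ ψ ⇔[∅] θ ⊔ χ.not := by
  obtain ⟨θ, hθ, χ, hχ, h⟩ := hφ
  obtain ⟨θ', hθ', χ', hχ', h'⟩ := hψ
  refine ⟨_, hF.sup hθ hθ', _, hF.inf hχ hχ', iff_of_forall_trueAt_iff.{0} fun U _ a => ?_⟩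
  simp only [trueAt_sup, trueAt_inf, trueAt_not, trueAt_iff_of_iff h, trueAt_iff_of_iff h']
  tauto

theorem exists_inf_not_iff_inf {φ ψ : CorrFormula Θ} (hφ : ∃ θ ∈ F, ∃ χ ∈ F, φ ⇔[∅] θ ⊓ χ.not)
    (hψ : ∃ θ ∈ F, ∃ χ ∈ F, ψ ⇔[∅] θ ⊓ χ.not) :
    ∃ θ ∈ F, ∃ χ ∈ F, φ ⊓ ψ ⇔[∅] θ ⊓ χ.not := by
  obtain ⟨θ, hθ, χ, hχ, h⟩ := hφ
  obtain ⟨θ', hθ', χ', hχ', h'⟩ := hψ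
  refine ⟨_, hF.inf hθ hθ', _, hF.sup hχ hχ', iff_of_forall_trueAt_iff.{0} fun U _ a => ?_⟩
  simp only [trueAt_sup, trueAt_inf, trueAt_not, trueAt_iff_of_iff h, trueAt_iff_of_iff h']
  tauto

theorem exists_listJoin_all_iff_sup_not (l : List (CorrFormula Θ))
    (hl : ∀ θ ∈ l, θ ∈ F ∪ Language.Formula.not '' F) :
    ∃ θ ∈ F, ∃ χ ∈ F, listJoin .all l ⇔[∅] θ ⊔ χ.not := by
  refine listJoin_all_induction (P := fun φ => ∃ θ ∈ F, ∃ χ ∈ F, φ ⇔[∅] θ ⊔ χ.not)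
    ⟨⊥, hF.bot, ⊤, hF.top, ?_⟩
    (fun _ _ => hF.exists_sup_not_iff_sup) l fun φ hφ => ?_
  · exact iff_of_forall_trueAt_iff.{0} fun U _ a => by simp
  · obtain h | ⟨χ, hχ, rfl⟩ := hl φ hφ
    · exact ⟨φ, h, ⊤, hF.top, iff_of_forall_trueAt_iff.{0} fun U _ a => by simp⟩
    · exact ⟨⊥, hF.bot, χ, hχ, iff_of_forall_trueAt_iff.{0} fun U _ a => by simp⟩

theorem exists_listJoin_ex_iff_inf_not (l : List (CorrFormula Θ))
    (hl : ∀ θ ∈ l, θ ∈ F ∪ Language.Formula.not '' F) :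
    ∃ θ ∈ F, ∃ χ ∈ F, listJoin .ex l ⇔[∅] θ ⊓ χ.not := by
  refine listJoin_ex_induction (P := fun φ => ∃ θ ∈ F, ∃ χ ∈ F, φ ⇔[∅] θ ⊓ χ.not)
    ⟨⊤, hF.top, ⊥, hF.bot, ?_⟩
    (fun _ _ => hF.exists_inf_not_iff_inf) l fun φ hφ => ?_
  · exact iff_of_forall_trueAt_iff.{0} fun U _ a => by simp
  · obtain h | ⟨χ, hχ, rfl⟩ := hl φ hφ
    · exact ⟨φ, h, ⊥, hF.bot, iff_of_forall_trueAt_iff.{0} fun U _ a => by simp⟩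
    · exact ⟨⊤, hF.top, χ, hχ, iff_of_forall_trueAt_iff.{0} fun U _ a => by simp⟩

end IsLatticeClosed

/-! ### Boolean functions -/

section BooleanFunctions

variable {k : ℕ} {f : (Fin k → Bool) → Bool}

theorem not_monotone_iff_exists :
    ¬ Monotone f ↔ ∃ v w, v ≤ w ∧ f v = true ∧ f w = false := by
  simp [Monotone, Bool.le_iff_imp]

theorem not_antitone_iff_exists :
    ¬ Antitone f ↔ ∃ v w, v ≤ w ∧ f v = false ∧ f w = true := by
  simp only [Antitone, Bool.le_iff_imp]
  push Not
  simp [and_comm]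

theorem Monotone.isConstantFn (hm : Monotone f) (ha : Antitone f) : IsConstantFn f := by
  have h : ∀ v, f v = f ⊥ := fun v => le_antisymm (ha bot_le) (hm bot_le)
  exact fun v w => (h v).trans (h w).symm

theorem lt_of_le_of_apply_ne {v w : Fin k → Bool} (h : v ≤ w) (hf : f v ≠ f w) : v < w :=
  lt_of_le_of_ne h fun e => hf (congrArg f e)

/-- A rest function has both a descent and an ascent. Value `0` at the bottom, followed by the
descent, would be FTF; so would the ascent followed by value `0` at the top. Hence both extremes
have value `1`, with a `0` in between. -/
theorem IsRest.isTFT (hf : IsRest f) (h : ¬ IsFTF f) : IsTFT f := by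
  obtain ⟨v, w, hvw, hv, hw⟩ := not_monotone_iff_exists.1 hf.1
  obtain ⟨v', w', hvw', hv', hw'⟩ := not_antitone_iff_exists.1 hf.2
  have hbot : f ⊥ = true := by
    by_contra hb
    rw [Bool.not_eq_true] at hb
    exact h ⟨⊥, v, w, lt_of_le_of_apply_ne (f := f) bot_le (by simp [hb, hv]),
      lt_of_le_of_apply_ne (f := f) hvw (by simp [hv, hw]), hb, hv, hw⟩
  have htop : f ⊤ = true := by
    by_contra hb
    rw [Bool.not_eq_true] at hb
    exact h ⟨v', w', ⊤, lt_of_le_of_apply_ne (f := f) hvw' (by simp [hv', hw']),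
      lt_of_le_of_apply_ne (f := f) le_top (by simp [hb, hw']), hv', hw', hb⟩
  exact ⟨⊥, w, ⊤, lt_of_le_of_apply_ne (f := f) bot_le (by simp [hbot, hw]),
    lt_of_le_of_apply_ne (f := f) le_top (by simp [htop, hw]), hbot, hw, htop⟩

theorem not_comp_isFTF : IsFTF (fun v => !f v) ↔ IsTFT f := by
  simp [IsFTF, IsTFT]

theorem not_comp_isTFT : IsTFT (fun v => !f v) ↔ IsFTF f := by
  simp [IsFTF, IsTFT]

theorem not_comp_monotone : Monotone (fun v => !f v) ↔ Antitone f := by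
  rw [← not_iff_not, not_monotone_iff_exists, not_antitone_iff_exists]
  simp

theorem not_comp_antitone : Antitone (fun v => !f v) ↔ Monotone f := by
  rw [← not_iff_not, not_monotone_iff_exists, not_antitone_iff_exists]
  simp

theorem IsRest.isFTF (hf : IsRest f) (h : ¬ IsTFT f) : IsFTF f := by
  rw [← not_comp_isTFT]
  refine IsRest.isTFT ⟨?_, ?_⟩ (by rwa [not_comp_isFTF])
  · rw [not_comp_monotone]; exact hf.2
  · rw [not_comp_antitone]; exact hf.1

/-- A function that is not `FTF` is the join of a monotone function and an antitone one. -/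
theorem exists_eq_monotone_or_antitone (h : ¬ IsFTF f) :
    ∃ g₁ g₂ : (Fin k → Bool) → Bool, Monotone g₁ ∧ Monotone g₂ ∧ ∀ v, f v = (g₁ v || !g₂ v) := by
  classical
  -- `g₁ v` says that `f` holds everywhere above `v`, and `!g₂ v` that it holds everywhere below. If
  -- `f v` is true and both fail, `v` lies between two zeros.
  refine ⟨fun v => decide (∀ w, v ≤ w → f w = true), fun v => !decide (∀ w, w ≤ v → f w = true),
    fun v w hvw => ?_, fun v w hvw => ?_, fun v => ?_⟩
  · simp only [Bool.le_iff_imp, decide_eq_true_eq]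
    exact fun h u hu => h u (hvw.trans hu)
  · simp only [Bool.le_iff_imp, Bool.not_eq_true', decide_eq_false_iff_not]
    exact fun h h' => h fun u hu => h' u (hu.trans hvw)
  · rw [Bool.eq_iff_iff]
    simp only [Bool.not_not, Bool.or_eq_true, decide_eq_true_eq]
    constructor
    · intro hv
      by_contra! hcon
      obtain ⟨⟨w, hvw, hw⟩, u, huv, hu⟩ := hcon
      simp only [ne_eq, Bool.not_eq_true] at hw hu
      exact h ⟨u, v, w, lt_of_le_of_apply_ne (f := f) huv (by simp [hu, hv]),
        lt_of_le_of_apply_ne (f := f) hvw (by simp [hv, hw]), hu, hv, hw⟩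
    · rintro (h | h)
      · exact h v le_rfl
      · exact h v le_rfl

end BooleanFunctions

/-! ### Boolean combinations of formulas of a lattice -/

/-- The formulas equivalent to some `b(ψ₁, …, ψ_k)` with all `ψᵢ` in `F`. -/
def boolSpan {k : ℕ} (b : BoolComb k) (F : Set (CorrFormula Θ)) : Set (CorrFormula Θ) :=
  {χ | ∃ ψ : Fin k → CorrFormula Θ, (∀ i, ψ i ∈ F) ∧ χ ⇔[∅] b.apply ψ}

theorem boolSpan_congr {k : ℕ} {b : BoolComb k} {F : Set (CorrFormula Θ)} {φ χ : CorrFormula Θ}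
    (hφ : φ ∈ boolSpan b F) (h : χ ⇔[∅] φ) : χ ∈ boolSpan b F := by
  obtain ⟨ψ, hψ, h'⟩ := hφ
  exact ⟨ψ, hψ, h.trans h'⟩

namespace IsLatticeClosed

variable {F : Set (CorrFormula Θ)} (hF : IsLatticeClosed F) {k : ℕ} {b : BoolComb k}
include hF

open Classical in
-- The arguments are chosen among `⊤`, `θ`, `θ ∧ χ`, `⊥` so that their truth vector is `v₀`, `v₁` or
-- `v₂` according to how much of `θ`, `θ ∧ χ` is true. All expressibility results come from suitable
-- chains of this kind, possibly degenerate.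
theorem mem_boolSpan_of_chain {v₀ v₁ v₂ : Fin k → Bool} (h₀₁ : v₀ ≤ v₁) (h₁₂ : v₁ ≤ v₂)
    {θ χ η : CorrFormula Θ} (hθ : θ ∈ F) (hχ : χ ∈ F)
    (hη : ∀ (U : Type) [(corrLang Θ).Structure U] (a : U), TrueAt a η ↔
      b.eval (if TrueAt a θ then if TrueAt a χ then v₂ else v₁ else v₀) = true) :
    η ∈ boolSpan b F := by
  refine ⟨fun i => if v₀ i then ⊤ else if v₁ i then θ else if v₂ i then θ ⊓ χ else ⊥,
    fun i => ?_, iff_of_forall_trueAt_iff.{0} fun U _ a => ?_⟩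
  · dsimp only
    split_ifs
    exacts [hF.top, hθ, hF.inf hθ hχ, hF.bot]
  · rw [hη, trueAt_boolComb]
    refine iff_of_eq (congrArg (b.eval · = true) (funext fun i => ?_))
    have h1 := h₀₁ i
    have h2 := h₁₂ i
    rw [Bool.le_iff_imp] at h1 h2
    rw [Bool.eq_iff_iff, truthValues_eq_true]
    by_cases hθa : TrueAt a θ <;> by_cases hχa : TrueAt a χ <;> cases e0 : v₀ i <;>
      cases e1 : v₁ i <;> cases e2 : v₂ i <;> simp_all

theorem mem_boolSpan_of_not_antitone (hb : ¬ Antitone b.eval) {θ : CorrFormula Θ} (hθ : θ ∈ F) :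
    θ ∈ boolSpan b F := by
  obtain ⟨v, w, hvw, hv, hw⟩ := not_antitone_iff_exists.1 hb
  refine hF.mem_boolSpan_of_chain hvw le_rfl hθ hθ fun U _ a => ?_
  by_cases h : TrueAt a θ <;> simp [h, hv, hw]

theorem not_mem_boolSpan_of_not_monotone (hb : ¬ Monotone b.eval) {θ : CorrFormula Θ}
    (hθ : θ ∈ F) : θ.not ∈ boolSpan b F := by
  obtain ⟨v, w, hvw, hv, hw⟩ := not_monotone_iff_exists.1 hb
  refine hF.mem_boolSpan_of_chain hvw le_rfl hθ hθ fun U _ a => ?_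
  by_cases h : TrueAt a θ <;> simp [h, hv, hw]

theorem sup_not_mem_boolSpan_of_isTFT (hb : IsTFT b.eval) {θ χ : CorrFormula Θ} (hθ : θ ∈ F)
    (hχ : χ ∈ F) : θ ⊔ χ.not ∈ boolSpan b F := by
  obtain ⟨v₀, v₁, v₂, h₀₁, h₁₂, h₀, h₁, h₂⟩ := hb
  refine hF.mem_boolSpan_of_chain h₀₁.le h₁₂.le hχ hθ fun U _ a => ?_
  by_cases h : TrueAt a θ <;> by_cases h' : TrueAt a χ <;> simp [h, h', h₀, h₁, h₂]

theorem inf_not_mem_boolSpan_of_isFTF (hb : IsFTF b.eval) {θ χ : CorrFormula Θ} (hθ : θ ∈ F)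
    (hχ : χ ∈ F) : θ ⊓ χ.not ∈ boolSpan b F := by
  obtain ⟨v₀, v₁, v₂, h₀₁, h₁₂, h₀, h₁, h₂⟩ := hb
  refine hF.mem_boolSpan_of_chain h₀₁.le h₁₂.le hθ hχ fun U _ a => ?_
  by_cases h : TrueAt a θ <;> by_cases h' : TrueAt a χ <;> simp [h, h', h₀, h₁, h₂]

theorem top_mem_boolSpan {v : Fin k → Bool} (hv : b.eval v = true) : ⊤ ∈ boolSpan b F :=
  hF.mem_boolSpan_of_chain (le_refl v) (le_refl v) hF.top hF.top fun U _ a => by simp [hv]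

theorem bot_mem_boolSpan {v : Fin k → Bool} (hv : b.eval v = false) : ⊥ ∈ boolSpan b F :=
  hF.mem_boolSpan_of_chain (le_refl v) (le_refl v) hF.top hF.top fun U _ a => by simp [hv]

/-- Negation-free disjunctive normal form: one conjunction of the required `ψ i` for each `v` with
`g v = true`. -/
theorem exists_trueAt_iff_of_monotone {g : (Fin k → Bool) → Bool} (hg : Monotone g)
    {ψ : Fin k → CorrFormula Θ} (hψ : ∀ i, ψ i ∈ F) :
    ∃ θ ∈ F, ∀ (U : Type) [(corrLang Θ).Structure U] (a : U),
      TrueAt a θ ↔ g (truthValues ψ a) = true := by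
  refine ⟨listJoin .all ((Finset.univ.filter (g · = true)).toList.map fun v =>
    listJoin .ex ((Finset.univ.filter (v · = true)).toList.map ψ)), ?_, fun U _ a => ?_⟩
  · refine hF.listJoin_mem _ _ fun θ hθ => ?_
    obtain ⟨v, -, rfl⟩ := List.mem_map.1 hθ
    refine hF.listJoin_mem _ _ fun θ hθ => ?_
    obtain ⟨i, -, rfl⟩ := List.mem_map.1 hθ
    exact hψ i
  · simp only [trueAt_listJoin_all, trueAt_listJoin_ex, List.mem_map, Finset.mem_toList,
      Finset.mem_filter, Finset.mem_univ, true_and, exists_exists_and_eq_and,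
      forall_exists_index, and_imp, forall_apply_eq_imp_iff₂]
    constructor
    · rintro ⟨v, hv, h⟩
      refine Bool.le_iff_imp.1 (hg fun i => ?_) hv
      rw [Bool.le_iff_imp, truthValues_eq_true]
      exact h i
    · exact fun h => ⟨_, h, fun i hi => truthValues_eq_true.1 hi⟩

theorem mem_of_mem_boolSpan_of_monotone (hb : Monotone b.eval) {χ : CorrFormula Θ}
    (hχ : χ ∈ boolSpan b F) : χ ∈ F := by
  obtain ⟨ψ, hψ, h⟩ := hχ
  obtain ⟨θ, hθ, h'⟩ := hF.exists_trueAt_iff_of_monotone hb hψ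
  refine hF.congr hθ (iff_of_forall_trueAt_iff.{0} fun U _ a => ?_)
  rw [h', trueAt_iff_of_iff h, trueAt_boolComb]

theorem exists_iff_not_of_antitone (hb : Antitone b.eval) {χ : CorrFormula Θ}
    (hχ : χ ∈ boolSpan b F) : ∃ θ ∈ F, χ ⇔[∅] θ.not := by
  obtain ⟨ψ, hψ, h⟩ := hχ
  obtain ⟨θ, hθ, h'⟩ := hF.exists_trueAt_iff_of_monotone (not_comp_monotone.2 hb) hψ
  refine ⟨θ, hθ, iff_of_forall_trueAt_iff.{0} fun U _ a => ?_⟩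
  rw [trueAt_not, h', trueAt_iff_of_iff h, trueAt_boolComb]
  simp

theorem exists_iff_sup_not (hb : ¬ IsFTF b.eval) {χ : CorrFormula Θ} (hχ : χ ∈ boolSpan b F) :
    ∃ θ ∈ F, ∃ θ' ∈ F, χ ⇔[∅] θ ⊔ θ'.not := by
  obtain ⟨ψ, hψ, h⟩ := hχ
  obtain ⟨g₁, g₂, hg₁, hg₂, hg⟩ := exists_eq_monotone_or_antitone hb
  obtain ⟨θ, hθ, h₁⟩ := hF.exists_trueAt_iff_of_monotone hg₁ hψ
  obtain ⟨θ', hθ', h₂⟩ := hF.exists_trueAt_iff_of_monotone hg₂ hψ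
  refine ⟨θ, hθ, θ', hθ', iff_of_forall_trueAt_iff.{0} fun U _ a => ?_⟩
  rw [trueAt_sup, trueAt_not, h₁, h₂, trueAt_iff_of_iff h, trueAt_boolComb, hg]
  simp

theorem exists_iff_inf_not (hb : ¬ IsTFT b.eval) {χ : CorrFormula Θ} (hχ : χ ∈ boolSpan b F) :
    ∃ θ ∈ F, ∃ θ' ∈ F, χ ⇔[∅] θ ⊓ θ'.not := by
  obtain ⟨ψ, hψ, h⟩ := hχ
  obtain ⟨g₁, g₂, hg₁, hg₂, hg⟩ := exists_eq_monotone_or_antitone (mt not_comp_isFTF.1 hb)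
  obtain ⟨θ, hθ, h₁⟩ := hF.exists_trueAt_iff_of_monotone hg₂ hψ
  obtain ⟨θ', hθ', h₂⟩ := hF.exists_trueAt_iff_of_monotone hg₁ hψ
  refine ⟨θ, hθ, θ', hθ', iff_of_forall_trueAt_iff.{0} fun U _ a => ?_⟩
  have := hg (truthValues ψ a)
  rw [trueAt_inf, trueAt_not, h₁, h₂, trueAt_iff_of_iff h, trueAt_boolComb]
  cases e : b.eval (truthValues ψ a) <;> cases e1 : g₁ (truthValues ψ a) <;>
    cases e2 : g₂ (truthValues ψ a) <;> simp_all

/-- According to the core, the span consists of the formulas equivalent to some `θ`, some `¬θ`, or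
some `θ ∨ ¬χ` with `θ`, `χ` in `F`. Each of these classes is closed under `∨`. -/
theorem sup_mem_boolSpan (hc : ¬ IsConstantFn b.eval) (hb : ¬ IsFTF b.eval)
    {φ χ : CorrFormula Θ} (hφ : φ ∈ boolSpan b F) (hχ : χ ∈ boolSpan b F) :
    φ ⊔ χ ∈ boolSpan b F := by
  by_cases hm : Monotone b.eval
  · exact hF.mem_boolSpan_of_not_antitone (fun ha => hc (hm.isConstantFn ha))
      (hF.sup (hF.mem_of_mem_boolSpan_of_monotone hm hφ) (hF.mem_of_mem_boolSpan_of_monotone hm hχ))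
  by_cases ha : Antitone b.eval
  · obtain ⟨θ, hθ, h⟩ := hF.exists_iff_not_of_antitone ha hφ
    obtain ⟨θ', hθ', h'⟩ := hF.exists_iff_not_of_antitone ha hχ
    refine boolSpan_congr (hF.not_mem_boolSpan_of_not_monotone hm (hF.inf hθ hθ'))
      (iff_of_forall_trueAt_iff.{0} fun U _ a => ?_)
    simp [trueAt_iff_of_iff h, trueAt_iff_of_iff h', imp_iff_not_or]
  · obtain ⟨θ, hθ, θ', hθ', h⟩ := hF.exists_sup_not_iff_sup
      (hF.exists_iff_sup_not hb hφ) (hF.exists_iff_sup_not hb hχ)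
    exact boolSpan_congr (hF.sup_not_mem_boolSpan_of_isTFT (IsRest.isTFT ⟨hm, ha⟩ hb) hθ hθ') h

theorem inf_mem_boolSpan (hc : ¬ IsConstantFn b.eval) (hb : ¬ IsTFT b.eval)
    {φ χ : CorrFormula Θ} (hφ : φ ∈ boolSpan b F) (hχ : χ ∈ boolSpan b F) :
    φ ⊓ χ ∈ boolSpan b F := by
  by_cases hm : Monotone b.eval
  · exact hF.mem_boolSpan_of_not_antitone (fun ha => hc (hm.isConstantFn ha))
      (hF.inf (hF.mem_of_mem_boolSpan_of_monotone hm hφ) (hF.mem_of_mem_boolSpan_of_monotone hm hχ))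
  by_cases ha : Antitone b.eval
  · obtain ⟨θ, hθ, h⟩ := hF.exists_iff_not_of_antitone ha hφ
    obtain ⟨θ', hθ', h'⟩ := hF.exists_iff_not_of_antitone ha hχ
    refine boolSpan_congr (hF.not_mem_boolSpan_of_not_monotone hm (hF.sup hθ hθ'))
      (iff_of_forall_trueAt_iff.{0} fun U _ a => ?_)
    simp [trueAt_iff_of_iff h, trueAt_iff_of_iff h']
  · obtain ⟨θ, hθ, θ', hθ', h⟩ := hF.exists_inf_not_iff_inf
      (hF.exists_iff_inf_not hb hφ) (hF.exists_iff_inf_not hb hχ)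
    exact boolSpan_congr (hF.inf_not_mem_boolSpan_of_isFTF (IsRest.isFTF ⟨hm, ha⟩ hb) hθ hθ') h

theorem listJoin_mem_boolSpan_of_not_antitone (hb : ¬ Antitone b.eval) (Q : Quant)
    (l : List (CorrFormula Θ)) (hl : ∀ θ ∈ l, θ ∈ F) : listJoin Q l ∈ boolSpan b F :=
  hF.mem_boolSpan_of_not_antitone hb (hF.listJoin_mem Q l hl)

theorem listJoin_mem_boolSpan_of_not_monotone (hb : ¬ Monotone b.eval) (Q : Quant)
    (l : List (CorrFormula Θ)) (hl : ∀ θ ∈ l, θ ∈ Language.Formula.not '' F) :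
    listJoin Q l ∈ boolSpan b F := by
  obtain ⟨θ, hθ, h⟩ := hF.exists_listJoin_iff_not Q l hl
  exact boolSpan_congr (hF.not_mem_boolSpan_of_not_monotone hb hθ) h

theorem listJoin_mem_boolSpan_of_not_weaklySpecialFn {Q : Quant}
    (hb : ¬ WeaklySpecialFn Q b.eval) (l : List (CorrFormula Θ))
    (hl : ∀ θ ∈ l, θ ∈ F ∪ Language.Formula.not '' F) : listJoin Q l ∈ boolSpan b F := by
  cases Q
  · obtain ⟨θ, hθ, χ, hχ, h⟩ := hF.exists_listJoin_all_iff_sup_not l hl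
    exact boolSpan_congr (hF.sup_not_mem_boolSpan_of_isTFT (not_not.1 hb) hθ hχ) h
  · obtain ⟨θ, hθ, χ, hχ, h⟩ := hF.exists_listJoin_ex_iff_inf_not l hl
    exact boolSpan_congr (hF.inf_not_mem_boolSpan_of_isFTF (not_not.1 hb) hθ hχ) h

end IsLatticeClosed

/-- The formulas equivalent to a guarded quantification of a formula of `G`. -/
def guardSpan (Q : Quant) {m : ℕ} (S : Fin (m + 1) → ℕ) (G : Set (CorrFormula Θ)) :
    Set (CorrFormula Θ) :=
  {χ | ∃ η ∈ G, χ ⇔[∅] guardFormula Q S η}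

/-- Since the inner quantifier is dual to the outer one, it distributes over the joins that the
outer one requires. A non-constant core takes both values, which accounts for the empty join. -/
theorem IsLatticeClosed.listJoin_mem_guardSpan {F : Set (CorrFormula Θ)} (hF : IsLatticeClosed F)
    {k : ℕ} {b : BoolComb k} (hc : ¬ IsConstantFn b.eval) {Q Q' : Quant} (hQ : Q' ≠ Q)
    (hb : WeaklySpecialFn Q' b.eval) {m : ℕ} {S : Fin (m + 1) → ℕ} (l : List (CorrFormula Θ))
    (hl : ∀ θ ∈ l, θ ∈ guardSpan Q' S (boolSpan b F)) :
    listJoin Q l ∈ guardSpan Q' S (boolSpan b F) := by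
  cases Q <;> cases Q' <;> first | exact absurd rfl hQ | skip
  · have ⟨v, hv⟩ : ∃ v, b.eval v = false := by
      by_contra! h
      simp only [ne_eq, Bool.not_eq_false] at h
      exact hc fun v w => (h v).trans (h w).symm
    refine listJoin_all_induction (P := (· ∈ guardSpan .ex S (boolSpan b F)))
      ⟨⊥, hF.bot_mem_boolSpan hv, ?_⟩ ?_ l hl
    · exact iff_of_forall_trueAt_iff.{0} fun U _ a => by simp [trueAt_guardFormula_ex]
    · rintro φ ψ ⟨η, hη, h⟩ ⟨η', hη', h'⟩
      refine ⟨_, hF.sup_mem_boolSpan hc hb hη hη', iff_of_forall_trueAt_iff.{0} fun U _ a => ?_⟩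
      simp [trueAt_iff_of_iff h, trueAt_iff_of_iff h', trueAt_guardFormula_ex, and_or_left,
        exists_or]
  · have ⟨v, hv⟩ : ∃ v, b.eval v = true := by
      by_contra! h
      simp only [ne_eq, Bool.not_eq_true] at h
      exact hc fun v w => (h v).trans (h w).symm
    refine listJoin_ex_induction (P := (· ∈ guardSpan .all S (boolSpan b F)))
      ⟨⊤, hF.top_mem_boolSpan hv, ?_⟩ ?_ l hl
    · exact iff_of_forall_trueAt_iff.{0} fun U _ a => by simp [trueAt_guardFormula_all]
    · rintro φ ψ ⟨η, hη, h⟩ ⟨η', hη', h'⟩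
      refine ⟨_, hF.inf_mem_boolSpan hc hb hη hη', iff_of_forall_trueAt_iff.{0} fun U _ a => ?_⟩
      simp [trueAt_iff_of_iff h, trueAt_iff_of_iff h', trueAt_guardFormula_all, imp_and,
        forall_and]

end Closure

/-! ### Inclusion of theories is an asimulation between saturated models -/

section Asimulation

variable {Θ : Set ℕ} {U₁ U₂ : Type*} [(corrLang Θ).Structure U₁] [(corrLang Θ).Structure U₂]
  {F : Set (CorrFormula Θ)} {k : ℕ} {b : BoolComb k}

theorem trueAt_of_forall_imp_of_not_closed {U V : Type*} [(corrLang Θ).Structure U]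
    [(corrLang Θ).Structure V] (h : ∀ θ ∈ F, θ.not ∈ F) {a : U} {b : V}
    (hab : ∀ θ ∈ F, TrueAt a θ → TrueAt b θ) : ∀ θ ∈ F, TrueAt b θ → TrueAt a θ := by
  intro θ hθ hb
  by_contra ha
  exact trueAt_not.1 (hab _ (h θ hθ) (trueAt_not.2 ha)) hb

theorem inclusionRel_inv_eq_self (h : ∀ θ ∈ F, θ.not ∈ F) :
    (inclusionRel U₁ U₂ F).inv = inclusionRel U₁ U₂ F := by
  ext a b <;> exact ⟨trueAt_of_forall_imp_of_not_closed h, trueAt_of_forall_imp_of_not_closed h⟩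

/-- A non-monotone core expresses negation, so `F` is then closed under `¬` and the inclusion
relation equals its own inverse. -/
theorem IsLatticeClosed.inclusionRel_mem_boolOp (hF : IsLatticeClosed F)
    (hb : boolSpan b F ⊆ F) : inclusionRel U₁ U₂ F ∈ boolOp b.eval {inclusionRel U₁ U₂ F} := by
  have hinv : ¬ Monotone b.eval → (inclusionRel U₁ U₂ F).inv = inclusionRel U₁ U₂ F := fun hm =>
    inclusionRel_inv_eq_self fun θ hθ => hb (hF.not_mem_boolSpan_of_not_monotone hm hθ)
  unfold boolOp
  split_ifs with hc hm ha
  · trivial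
  · rfl
  · exact ⟨_, rfl, hinv hm⟩
  · refine ⟨_, rfl, ?_⟩
    dsimp only
    rw [hinv hm, inclusionRel_inter, Set.union_self]

/-- The witness is the inclusion relation for `∅`, `F`, `¬F` or `F ∪ ¬F`, as the core is constant,
monotone, antitone or rest. In the last case, not being special provides the TFT or FTF chain needed
for the mixed joins. -/
theorem IsLatticeClosed.exists_mem_boolOp_stepCond (hF : IsLatticeClosed F)
    (h₁ : PathSaturated Θ U₁) (h₂ : PathSaturated Θ U₂) {Q : Quant} {m : ℕ}
    {S : Fin (m + 1) → ℕ} {G : Set (CorrFormula Θ)}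
    (hG : ∀ η ∈ boolSpan b F, guardFormula Q S η ∈ G)
    (hconst : IsConstantFn b.eval → listJoin Q [] ∈ boolSpan b F)
    (hs : ¬ SpecialFn Q b.eval) :
    ∃ B ∈ boolOp b.eval {inclusionRel U₁ U₂ F},
      StepCond Θ Q S (inclusionRel U₁ U₂ G) B := by
  unfold boolOp
  split_ifs with hc hm ha
  · refine ⟨_, Set.mem_univ _, stepCond_inclusionRel h₁ h₂ (H := ∅) fun l hl => hG _ ?_⟩
    rw [List.eq_nil_iff_forall_not_mem.2 hl]
    exact hconst hc
  · exact ⟨_, rfl, stepCond_inclusionRel h₁ h₂ fun l hl => hG _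
      (hF.listJoin_mem_boolSpan_of_not_antitone (fun ha => hc (hm.isConstantFn ha)) Q l hl)⟩
  · refine ⟨_, ⟨_, rfl, rfl⟩, ?_⟩
    rw [inclusionRel_inv]
    exact stepCond_inclusionRel h₁ h₂ fun l hl => hG _
      (hF.listJoin_mem_boolSpan_of_not_monotone hm Q l hl)
  · refine ⟨_, ⟨_, rfl, rfl⟩, ?_⟩
    dsimp only
    rw [inclusionRel_inv, inclusionRel_inter]
    exact stepCond_inclusionRel h₁ h₂ fun l hl => hG _
      (hF.listJoin_mem_boolSpan_of_not_weaklySpecialFn (fun hw => hs ⟨⟨hm, ha⟩, hw⟩) l hl)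

/-- For a special core, joins from `F` and from `¬F` are needed only separately, and any rest
function expresses both. The set `G` is kept arbitrary: it is `F` in degree 1 and `guardSpan` for
the inner block in degree 2. -/
theorem IsLatticeClosed.exists_connOp_guard_core (hF : IsLatticeClosed F)
    (h₁ : PathSaturated Θ U₁) (h₂ : PathSaturated Θ U₂) {Q : Quant} {m : ℕ}
    {S : Fin (m + 1) → ℕ} {G : Set (CorrFormula Θ)}
    (hG : ∀ η ∈ boolSpan b F, guardFormula Q S η ∈ G)
    (hconst : IsConstantFn b.eval → listJoin Q [] ∈ boolSpan b F) :
    ∃ t ∈ connOp Θ {inclusionRel U₁ U₂ F} (PreConn.guard Q m S (.core b)),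
      t (Fin.last _) = inclusionRel U₁ U₂ G := by
  by_cases hs : SpecialFn Q b.eval
  · refine ⟨![inclusionRel U₁ U₂ F, inclusionRel U₁ U₂ G],
      ⟨fun _ => ⟨rfl, ?_, ?_⟩, fun h => (h hs).elim⟩, rfl⟩
    · exact stepCond_inclusionRel h₁ h₂ fun l hl => hG _
        (hF.listJoin_mem_boolSpan_of_not_antitone hs.1.2 Q l hl)
    · change StepCond Θ Q S _ (inclusionRel U₁ U₂ F).inv
      rw [inclusionRel_inv]
      exact stepCond_inclusionRel h₁ h₂ fun l hl => hG _
        (hF.listJoin_mem_boolSpan_of_not_monotone hs.1.1 Q l hl)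
  · obtain ⟨B, hB, hstep⟩ := hF.exists_mem_boolOp_stepCond h₁ h₂ hG hconst hs
    exact ⟨![B, inclusionRel U₁ U₂ G], ⟨fun h => (hs h).elim, fun _ => ⟨hB, hstep⟩⟩, rfl⟩

theorem IsLatticeClosed.exists_connOp_guard_guard_core (hF : IsLatticeClosed F)
    (h₁ : PathSaturated Θ U₁) (h₂ : PathSaturated Θ U₂) {Q Q' : Quant} (hQ : Q' ≠ Q) {m m' : ℕ}
    {S : Fin (m + 1) → ℕ} {S' : Fin (m' + 1) → ℕ} (hc : ¬ IsConstantFn b.eval)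
    (hb : WeaklySpecialFn Q' b.eval)
    (h : ∀ η ∈ boolSpan b F, guardFormula Q S (guardFormula Q' S' η) ∈ F) :
    ∃ t ∈ connOp Θ {inclusionRel U₁ U₂ F} (PreConn.guard Q m S (.guard Q' m' S' (.core b))),
      t (Fin.last _) = inclusionRel U₁ U₂ F := by
  obtain ⟨t, ht, hlast⟩ := hF.exists_connOp_guard_core (G := guardSpan Q' S' (boolSpan b F)) h₁ h₂
    (Q := Q') (S := S') (fun η hη => ⟨η, hη, .refl _⟩) fun h => (hc h).elim
  obtain ⟨s, rfl, hs⟩ : ∃ s, Fin.init s = t ∧ s (Fin.last _) = inclusionRel U₁ U₂ F :=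
    ⟨Fin.snoc (α := fun _ => BiRel U₁ U₂) t _, Fin.init_snoc .., Fin.snoc_last ..⟩
  refine ⟨s, ⟨fun h => h.elim, fun _ => ⟨ht, ?_⟩⟩, hs⟩
  have key : StepCond Θ Q S (inclusionRel U₁ U₂ F)
      (inclusionRel U₁ U₂ (guardSpan Q' S' (boolSpan b F))) := by
    refine stepCond_inclusionRel h₁ h₂ fun l hl => ?_
    obtain ⟨η, hη, h'⟩ := hF.listJoin_mem_guardSpan hc hQ hb l hl
    exact hF.congr (h η hη) (guardFormula_iff_congr h').symm
  rw [← hs, ← hlast] at key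
  exact key

end Asimulation

/-! ### The fragment up to logical equivalence -/

section FragmentClosure

variable {Θ : Set ℕ} {𝕄 : Set Conn}

/-- The formulas equivalent to a formula of the fragment. -/
def fragmentClosure (Θ : Set ℕ) (𝕄 : Set Conn) : Set (CorrFormula Θ) :=
  {φ | ∃ ψ, Fragment Θ 𝕄 ψ ∧ φ ⇔[∅] ψ}

theorem fragmentClosure_congr {φ ψ : CorrFormula Θ} (hφ : φ ∈ fragmentClosure Θ 𝕄)
    (h : φ ⇔[∅] ψ) : ψ ∈ fragmentClosure Θ 𝕄 := by
  obtain ⟨χ, hχ, h'⟩ := hφ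
  exact ⟨χ, hχ, h.symm.trans h'⟩

theorem apply_mem_fragmentClosure {μ : Conn} (hμ : μ ∈ 𝕄) {ψ : Fin μ.1 → CorrFormula Θ}
    (hψ : ∀ i, ψ i ∈ fragmentClosure Θ 𝕄) : μ.2.apply ψ ∈ fragmentClosure Θ 𝕄 := by
  choose χ hχ h using hψ
  exact ⟨μ.2.apply χ, .app μ hμ χ hχ, iff_of_forall_trueAt_iff.{0} fun U _ a =>
    trueAt_apply_congr (fun _ _ => Iff.rfl) (fun i => trueAt_iff_of_iff (h i)) μ.2 a⟩

theorem ContainsConn.apply_mem_fragmentClosure {k : ℕ} {ν : PreConn k}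
    (hν : ContainsConn 𝕄 ⟨k, ν⟩) {ψ : Fin k → CorrFormula Θ}
    (hψ : ∀ i, ψ i ∈ fragmentClosure Θ 𝕄) : ν.apply ψ ∈ fragmentClosure Θ 𝕄 := by
  obtain ⟨⟨k, μ⟩, hμ, rfl, h⟩ := hν
  exact fragmentClosure_congr (_root_.apply_mem_fragmentClosure hμ hψ) (apply_iff_of_equivalent h ψ)

theorem isLatticeClosed_fragmentClosure (hand : ContainsConn 𝕄 connAnd)
    (hor : ContainsConn 𝕄 connOr) (hbot : ContainsConn 𝕄 connBot)
    (htop : ContainsConn 𝕄 connTop) : IsLatticeClosed (fragmentClosure Θ 𝕄) where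
  congr := fragmentClosure_congr
  top := htop.apply_mem_fragmentClosure (ψ := Fin.elim0) fun i => i.elim0
  bot := hbot.apply_mem_fragmentClosure (ψ := Fin.elim0) fun i => i.elim0
  inf {φ ψ} hφ hψ := hand.apply_mem_fragmentClosure (ψ := ![φ, ψ]) fun i => by
    fin_cases i
    exacts [hφ, hψ]
  sup {φ ψ} hφ hψ := hor.apply_mem_fragmentClosure (ψ := ![φ, ψ]) fun i => by
    fin_cases i
    exacts [hφ, hψ]

/-- By the minimality of its degree, a guarded connective of degree `1` with a constant core is
of the form `∀⊥` or `∃⊤`. -/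
theorem listJoin_nil_mem_boolSpan {F : Set (CorrFormula Θ)} (hF : IsLatticeClosed F) {k : ℕ}
    {b : BoolComb k} {Q : Quant} {m : ℕ} {S : Fin (m + 1) → ℕ}
    (hμ : (PreConn.guard Q m S (.core b)).IsGuardedConnective) (hc : IsConstantFn b.eval) :
    listJoin Q [] ∈ boolSpan b F := by
  rw [PreConn.IsGuardedConnective] at hμ
  have hmin : ∀ c : BoolComb k, ¬ (PreConn.guard Q m S (.core b)).Equivalent (.core c) :=
    fun c h => hμ.2.2 ⟨.core c, Nat.zero_lt_one, by rw [PreConn.IsGuardedConnective]; trivial, h⟩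
  cases Q
  · refine hF.bot_mem_boolSpan (v := ⊥) ?_
    by_contra hv
    -- A constantly true core under `∀` would make the connective equivalent to `⊤`, of degree 0.
    refine hmin .top (iff_of_forall_trueAt_iff.{0} fun U _ a => ?_)
    simp only [PreConn.toFormula, PreConn.apply, BoolComb.apply, trueAt_top, iff_true,
      trueAt_guardFormula_all, trueAt_boolComb]
    intro c _ _
    rw [hc _ ⊥]
    simpa using hv
  · refine hF.top_mem_boolSpan (v := ⊥) ?_
    by_contra hv
    refine hmin .bot (iff_of_forall_trueAt_iff.{0} fun U _ a => ?_)
    simp only [PreConn.toFormula, PreConn.apply, BoolComb.apply, trueAt_bot, iff_false,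
      trueAt_guardFormula_ex, trueAt_boolComb, not_exists, not_and]
    intro c _ _
    rw [hc _ ⊥]
    exact hv

theorem isAsimulation_inclusionRel {U₁ U₂ : Type*} [(corrLang Θ).Structure U₁]
    [(corrLang Θ).Structure U₂] (h₁ : PathSaturated Θ U₁) (h₂ : PathSaturated Θ U₂)
    (hstd : IsStandard 𝕄) (hF : IsLatticeClosed (fragmentClosure Θ 𝕄))
    (hne : (inclusionRel U₁ U₂ (fragmentClosure Θ 𝕄)).IsNonempty) :
    IsAsimulation Θ 𝕄 (inclusionRel U₁ U₂ (fragmentClosure Θ 𝕄)) := by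
  refine ⟨hne, fun n => ?_, fun ⟨k, μ⟩ hμ => ?_⟩
  · have hn : atomP n ∈ fragmentClosure Θ 𝕄 := ⟨_, .atom n, .refl _⟩
    exact ⟨fun _ _ h => h _ hn, fun _ _ h => h _ hn⟩
  obtain ⟨hg, hdeg⟩ := hstd.2 _ hμ
  match μ with
  | .core b =>
    refine ⟨fun _ => inclusionRel U₁ U₂ (fragmentClosure Θ 𝕄), ?_, rfl⟩
    refine hF.inclusionRel_mem_boolOp ?_
    rintro χ ⟨ψ, hψ, h⟩
    exact hF.congr (apply_mem_fragmentClosure hμ hψ) h.symm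
  | .guard Q m S (.core b) =>
    refine hF.exists_connOp_guard_core h₁ h₂ ?_ (listJoin_nil_mem_boolSpan hF hg)
    rintro η ⟨ψ, hψ, h⟩
    exact hF.congr (apply_mem_fragmentClosure hμ hψ) (guardFormula_iff_congr h).symm
  | .guard Q m S (.guard Q' m' S' (.core b)) =>
    obtain hflat | ⟨⟨⟨ν, hν, hν1, hw⟩, hc⟩, -⟩ := hdeg
    · simp [PreConn.IsFlat, PreConn.degree] at hflat
    have hw' : WeaklySpecialFn Q' b.eval := by
      obtain rfl | rfl | rfl := hν
      · exact hw.elim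
      · exact hw
      · exact hw.elim
    rw [PreConn.IsGuardedConnective] at hg
    refine hF.exists_connOp_guard_guard_core h₁ h₂ hg.2.1 hc hw' ?_
    rintro η ⟨ψ, hψ, h⟩
    exact hF.congr (apply_mem_fragmentClosure hμ hψ)
      (guardFormula_iff_congr (guardFormula_iff_congr h)).symm
  | .guard _ _ _ (.guard _ _ _ (.guard _ _ _ μ)) =>
    obtain hflat | ⟨-, h2⟩ := hdeg
    · simp [PreConn.IsFlat, PreConn.degree] at hflat
    · simp [PreConn.degree] at h2

/-- A formula outside a lattice of formulas is separated from it by two saturated models. -/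
theorem IsLatticeClosed.exists_pathSaturated_of_not_mem {F : Set (CorrFormula Θ)}
    (hF : IsLatticeClosed F) {φ : CorrFormula Θ} (hφ : φ ∉ F) :
    ∃ (U₁ U₂ : Type u) (_ : (corrLang Θ).Structure U₁) (_ : (corrLang Θ).Structure U₂)
      (a : U₁) (b : U₂), PathSaturated Θ U₁ ∧ PathSaturated Θ U₂ ∧ TrueAt a φ ∧ ¬ TrueAt b φ ∧
        ∀ θ ∈ F, TrueAt a θ → TrueAt b θ := by
  let C : Set (CorrFormula Θ) := {θ | θ ∈ F ∧
    ∀ (U : Type u) [(corrLang Θ).Structure U] (a : U), TrueAt a φ → TrueAt a θ}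
  -- If finitely many consequences of `φ` in `F` were inconsistent with `¬φ`, their conjunction
  -- would be equivalent to `φ`, putting `φ` in `F`.
  obtain ⟨U₂, _, b, hU₂, hb⟩ := exists_pathSaturated_of_finitely_satisfiable.{u}
    (fun θ : C => θ.1 ⊓ φ.not) (by
      intro l
      by_contra! hcon
      refine hφ (hF.congr (hF.listJoin_mem .ex (l.map Subtype.val) ?_)
        (iff_of_forall_trueAt_iff.{u} fun U _ a => ?_))
      · intro θ hθ
        obtain ⟨i, -, rfl⟩ := List.mem_map.1 hθ
        exact i.2.1
      · rw [trueAt_listJoin_ex]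
        constructor
        · intro h
          by_contra ha
          obtain ⟨i, hi, hia⟩ := hcon U inferInstance a
          exact hia (trueAt_inf.2 ⟨h _ (List.mem_map_of_mem hi), trueAt_not.2 ha⟩)
        · intro ha θ hθ
          obtain ⟨i, -, rfl⟩ := List.mem_map.1 hθ
          exact i.2.2 U a ha)
  have hbC : ∀ θ ∈ C, TrueAt b θ := fun θ hθ => (trueAt_inf.1 (hb ⟨θ, hθ⟩)).1
  have hbφ : ¬ TrueAt b φ :=
    trueAt_not.1 (trueAt_inf.1 (hb ⟨⊤, hF.top, fun _ _ _ _ => trueAt_top.2 trivial⟩)).2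
  -- If `φ` implied a finite disjunction of `F`-formulas false at `b`, that disjunction would lie in
  -- `C` and hence be true at `b`.
  obtain ⟨U₁, _, a, hU₁, ha⟩ := exists_pathSaturated_of_finitely_satisfiable.{u}
    (fun θ : {θ // θ ∈ F ∧ ¬ TrueAt b θ} => θ.1.not ⊓ φ) (by
      intro l
      by_contra! hcon
      have hmem : listJoin .all (l.map Subtype.val) ∈ C := by
        refine ⟨hF.listJoin_mem .all _ fun θ hθ => ?_, fun U _ a ha => ?_⟩
        · obtain ⟨i, -, rfl⟩ := List.mem_map.1 hθ
          exact i.2.1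
        · obtain ⟨i, hi, hia⟩ := hcon U inferInstance a
          refine trueAt_listJoin_all.2 ⟨_, List.mem_map_of_mem hi, ?_⟩
          by_contra h
          exact hia (trueAt_inf.2 ⟨trueAt_not.2 h, ha⟩)
      obtain ⟨θ, hθ, hbθ⟩ := trueAt_listJoin_all.1 (hbC _ hmem)
      obtain ⟨i, -, rfl⟩ := List.mem_map.1 hθ
      exact i.2.2 hbθ)
  refine ⟨U₁, U₂, _, _, a, b, hU₁, hU₂,
    (trueAt_inf.1 (ha ⟨⊥, hF.bot, trueAt_bot.1⟩)).2, hbφ, fun θ hθ => ?_⟩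
  contrapose
  exact fun h => trueAt_not.1 (trueAt_inf.1 (ha ⟨θ, hθ, h⟩)).1

end FragmentClosure

/-! ### The characterization theorem -/

theorem theorem1 (Θ : Set ℕ) (𝕄 : Set Conn) (hstd : IsStandard 𝕄)
    (hand : ContainsConn 𝕄 connAnd) (hor : ContainsConn 𝕄 connOr)
    (hbot : ContainsConn 𝕄 connBot) (htop : ContainsConn 𝕄 connTop)
    (φ : CorrFormula Θ) (hφ : IdentityFree φ) :
    (∃ ψ : CorrFormula Θ, Fragment Θ 𝕄 ψ ∧ (∅ : (corrLang Θ).Theory).Iff φ ψ) ↔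
      InvariantUnderAsimulations.{u} 𝕄 φ := by
  constructor
  · rintro ⟨ψ, hψ, h⟩ U₁ U₂ _ _ _ _ A hA
    simp only [InvariantUnder, trueAt_iff_of_iff h]
    exact hψ.invariantUnder hA
  · intro hinv
    by_contra hnot
    have hF := isLatticeClosed_fragmentClosure (Θ := Θ) hand hor hbot htop
    obtain ⟨U₁, U₂, _, _, a, b, h₁, h₂, ha, hb, hab⟩ :=
      hF.exists_pathSaturated_of_not_mem.{u} (φ := φ) hnot
    have : Nonempty U₁ := ⟨a⟩
    have : Nonempty U₂ := ⟨b⟩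
    have hA := isAsimulation_inclusionRel h₁ h₂ hstd hF (Or.inl ⟨a, b, hab⟩)
    exact hb ((hinv U₁ U₂ _ hA).1 a b hab ha)
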